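/- Let $G$ be a finite bipartite multigraph with parts $X$ and $Y$ and edge set $E$ (parallel edges allowed) in which every vertex of $X\cup Y$ has at least two distinct neighbours, and suppose that $G$ is $X$-surplus, that is, $|N(S)|>|S|$ for every nonempty proper subset $S\subsetneq X$, where $N(S)\subseteq Y$ is the set of vertices having a neighbour in $S$. Put $n=|X|$, $t=|Y|-|X|$ and $b=|E|-2|Y|$, and assume $n\ge 2$ and $t\ge 0$. Let $\Phi(G)$ be the number of maximum matchings of $G$, that is, of sets of pairwise disjoint edges of the largest possible size (parallel edges are distinct edges, so they give distinct matchings). Then $$\Phi(G)\ \ge\ \bigl[(n-1)t+2+b\bigr](t+1).$$ Moreover, the bound is sharp in all cases: for all integers $n\ge 2$, $t\ge 0$ and $b\ge 0$ there is a bipartite multigraph $G$ with parts $X,Y$ that is $X$-surplus, in which every vertex has at least two neighbours, with $|X|=n$, $|Y|=n+t$ and $|E|=2(n+t)+b$, such that $\Phi(G)=[(n-1)t+2+b](t+1)$. -/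

import Mathlib

/-- A bipartite multigraph with parts `X` and `Y` and edge set `E`: every edge has one endpoint
in `X` and one endpoint in `Y`; distinct edges may have the same endpoints. -/
structure Bigraph (X Y E : Type*) where
  /-- The endpoint of an edge in `X`. -/
  left : E → X
  /-- The endpoint of an edge in `Y`. -/
  right : E → Y

namespace Bigraph

noncomputable section

variable {X Y E : Type*}

open Classical in
/-- The neighbourhood `N(S) ⊆ Y` of a set `S ⊆ X`. -/
def nbhd [Fintype Y] (G : Bigraph X Y E) (S : Finset X) : Finset Y :=
  {y : Y | ∃ e : E, G.left e ∈ S ∧ G.right e = y}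

open Classical in
/-- The set of neighbours in `Y` of a vertex `x ∈ X`. -/
def nbrsLeft [Fintype Y] (G : Bigraph X Y E) (x : X) : Finset Y :=
  {y : Y | ∃ e : E, G.left e = x ∧ G.right e = y}

open Classical in
/-- The set of neighbours in `X` of a vertex `y ∈ Y`. -/
def nbrsRight [Fintype X] (G : Bigraph X Y E) (y : Y) : Finset X :=
  {x : X | ∃ e : E, G.left e = x ∧ G.right e = y}

/-- `|N(S)| > |S|` for every nonempty proper subset `S` of `X`. -/
def XSurplus [Fintype X] [Fintype Y] (G : Bigraph X Y E) : Prop :=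
  ∀ S : Finset X, S.Nonempty → S ⊂ Finset.univ → S.card < (G.nbhd S).card

/-- Every vertex, in either part, has at least two (distinct) neighbours. -/
def Leafless [Fintype X] [Fintype Y] (G : Bigraph X Y E) : Prop :=
  (∀ x : X, 2 ≤ (G.nbrsLeft x).card) ∧ (∀ y : Y, 2 ≤ (G.nbrsRight y).card)

/-- A matching is a set of edges no two of which share an endpoint. -/
def IsMatching (G : Bigraph X Y E) (M : Finset E) : Prop :=
  ∀ e ∈ M, ∀ f ∈ M, e ≠ f → G.left e ≠ G.left f ∧ G.right e ≠ G.right f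

/-- A maximum matching is a matching with the largest number of edges. -/
def IsMaximumMatching (G : Bigraph X Y E) (M : Finset E) : Prop :=
  G.IsMatching M ∧ ∀ M' : Finset E, G.IsMatching M' → M'.card ≤ M.card

open Classical in
/-- `Φ(G)`, the number of maximum matchings (as sets of edges, so that parallel edges
give different matchings). -/
def Phi [Fintype E] (G : Bigraph X Y E) : ℕ :=
  ({M : Finset E | G.IsMaximumMatching M} : Finset (Finset E)).card

end

end Bigraph

set_option linter.unusedSectionVars false

/-! Hall's condition holds, so the maximum matchings are those saturating X, and Φ is the number
P(A, B) of weighted injections of the rows A into the columns B (`matchCount`), a rectangular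
permanent. The bound is proved by strong induction on the number of edges.

If some edge xy can be removed without losing the hypotheses, it lies in at least t + 1 matchings
(`excess_add_one_le_matchCount`), which pays for one unit of b. Otherwise the graph is simple, and
each edge is needed either by a column of degree two or by a tight set, one with |N(S)| = |S| + 1.
Uncrossing tight sets and counting degrees then yields a column of degree exactly two
(`exists_card_rowNbrs_eq_two`).

Let u, v be its neighbours, K the set of all k columns with neighbourhood {u, v}, and D = B \ K.
Sorting matchings by their use of K gives P(A, B) = P(A, D) + k [P(A-u, D) + P(A-v, D)] + k(k-1)
P(A-u-v, D). The bracket counts matchings of the graph with u and v merged, which has one row fewer.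
If merging keeps the hypotheses, which is automatic for k = 1, induction and crude bounds on the
outer terms suffice. Otherwise every nonempty twin class may be taken to have at least two columns,
and a set obstructing the merge forces one of three configurations: u, v and K form a component;
they are attached to the rest by one edge; or they form a component with one further row. In each,
the terms with factors k and k(k-1) suffice after induction on the remaining rows.

Sharpness: take a cycle through the n rows and n columns, replace one column by t + 1 copies, and
give one edge multiplicity b + 1. -/

namespace Bigraph

/-! ### Rectangular permanents: expansions along rows and columns, merging of rows -/

section Count

variable {X Y : Type*} [DecidableEq Y]

/-- The weighted number of ways to choose distinct columns in `B` for the rows in the list. -/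
def listCount (w : X → Y → ℕ) : List X → Finset Y → ℕ
  | [], _ => 1
  | x :: l, B => ∑ y ∈ B, w x y * listCount w l (B.erase y)

/-- The weighted number of matchings of `A` into `B`, that is, the permanent of the
submatrix of `w` with rows `A` and columns `B`. -/
noncomputable def matchCount (w : X → Y → ℕ) (A : Finset X) (B : Finset Y) : ℕ :=
  listCount w A.toList B

/-- Exchanging two adjacent rows exchanges two nested sums over distinct columns. This frees
`matchCount` from the arbitrary order of `toList`. -/
theorem listCount_perm (w : X → Y → ℕ) {l l' : List X} (h : l.Perm l') (B : Finset Y) :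
    listCount w l B = listCount w l' B := by
  induction h generalizing B with
  | nil => rfl
  | cons x _ ih => simp [listCount, ih]
  | trans _ _ ih1 ih2 => rw [ih1, ih2]
  | swap x x' l =>
    simp only [listCount, Finset.mul_sum]
    rw [Finset.sum_comm' (s' := fun y => B.erase y) (t' := B)]
    · refine Finset.sum_congr rfl fun y _ => Finset.sum_congr rfl fun z _ => ?_
      rw [Finset.erase_right_comm]; ring
    · intro y z; simp only [Finset.mem_erase]; tauto

theorem matchCount_empty (w : X → Y → ℕ) (B : Finset Y) : matchCount w ∅ B = 1 := by
  simp [matchCount, listCount]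

variable [DecidableEq X]

theorem matchCount_insert (w : X → Y → ℕ) {x : X} {A : Finset X} (h : x ∉ A) (B : Finset Y) :
    matchCount w (insert x A) B = ∑ y ∈ B, w x y * matchCount w A (B.erase y) := by
  unfold matchCount
  rw [listCount_perm w (Finset.toList_insert h)]
  rfl

theorem matchCount_row (w : X → Y → ℕ) {x : X} {A : Finset X} (h : x ∈ A) (B : Finset Y) :
    matchCount w A B = ∑ y ∈ B, w x y * matchCount w (A.erase x) (B.erase y) := by
  rw [← matchCount_insert w (Finset.notMem_erase x A), Finset.insert_erase h]

theorem matchCount_congr {w w' : X → Y → ℕ} {A : Finset X} {B : Finset Y}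
    (h : ∀ x ∈ A, ∀ y ∈ B, w x y = w' x y) : matchCount w A B = matchCount w' A B := by
  induction A using Finset.induction_on generalizing B with
  | empty => simp [matchCount_empty]
  | insert a s ha ih =>
    rw [matchCount_insert w ha, matchCount_insert w' ha]
    refine Finset.sum_congr rfl fun y hy => ?_
    rw [h a (by simp) y hy, ih]
    intro x hx z hz
    exact h x (by simp [hx]) z (Finset.mem_of_mem_erase hz)

theorem matchCount_mono (w : X → Y → ℕ) (A : Finset X) {B B' : Finset Y} (h : B ⊆ B') :
    matchCount w A B ≤ matchCount w A B' := by
  induction A using Finset.induction_on generalizing B B' with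
  | empty => simp [matchCount_empty]
  | insert a s ha ih =>
    rw [matchCount_insert w ha, matchCount_insert w ha]
    calc ∑ y ∈ B, w a y * matchCount w s (B.erase y)
        ≤ ∑ y ∈ B, w a y * matchCount w s (B'.erase y) :=
          Finset.sum_le_sum fun y _ => Nat.mul_le_mul_left _ (ih (Finset.erase_subset_erase y h))
      _ ≤ _ := Finset.sum_le_sum_of_subset h

/-- A matching need not cover the column `y`, hence the extra term compared with a row expansion. -/
theorem matchCount_col (w : X → Y → ℕ) (A : Finset X) {B : Finset Y} {y : Y} (hy : y ∈ B) :
    matchCount w A B = matchCount w A (B.erase y) +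
      ∑ x ∈ A, w x y * matchCount w (A.erase x) (B.erase y) := by
  induction A using Finset.induction_on generalizing B with
  | empty => simp [matchCount_empty]
  | insert a s ha ih =>
    rw [matchCount_insert w ha, matchCount_insert w ha, Finset.sum_insert ha,
      Finset.erase_insert ha, ← Finset.add_sum_erase B _ hy]
    have h1 : ∀ z ∈ B.erase y, w a z * matchCount w s (B.erase z) =
        w a z * matchCount w s ((B.erase y).erase z) +
        ∑ x ∈ s, w x y * (w a z * matchCount w (s.erase x) ((B.erase y).erase z)) := by
      intro z hz
      have hyz : y ∈ B.erase z := by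
        simp only [Finset.mem_erase] at hz ⊢; exact ⟨hz.1.symm, hy⟩
      rw [ih hyz, mul_add, Finset.mul_sum, Finset.erase_right_comm]
      congr 1
      refine Finset.sum_congr rfl fun x _ => ?_
      ring
    have h2 : ∀ x ∈ s, w x y * matchCount w ((insert a s).erase x) (B.erase y) =
        ∑ z ∈ B.erase y, w x y * (w a z * matchCount w (s.erase x) ((B.erase y).erase z)) := by
      intro x hx
      have hne : a ≠ x := fun h => ha (h ▸ hx)
      rw [Finset.erase_insert_of_ne hne, matchCount_insert w (fun h => ha (Finset.mem_of_mem_erase h)),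
        Finset.mul_sum]
    rw [Finset.sum_congr rfl h1, Finset.sum_congr rfl h2, Finset.sum_add_distrib,
      Finset.sum_comm (s := s)]
    ring

theorem matchCount_erase_of_col_zero (w : X → Y → ℕ) (A : Finset X) (B : Finset Y) {y : Y}
    (h : ∀ x ∈ A, w x y = 0) : matchCount w A (B.erase y) = matchCount w A B := by
  by_cases hy : y ∈ B
  · rw [matchCount_col w A hy, Finset.sum_eq_zero, add_zero]
    intro x hx; simp [h x hx]
  · rw [Finset.erase_eq_of_notMem hy]

/-- Double counting: each matching is counted once for every column that it leaves free. -/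
theorem sum_matchCount_erase (w : X → Y → ℕ) (A : Finset X) (B : Finset Y) :
    ∑ y ∈ B, (matchCount w A (B.erase y) : ℤ) =
      ((B.card : ℤ) - A.card) * matchCount w A B := by
  induction A using Finset.induction_on generalizing B with
  | empty => simp [matchCount_empty]
  | insert a s ha ih =>
    simp only [matchCount_insert w ha, Nat.cast_sum, Nat.cast_mul]
    rw [Finset.sum_comm' (s' := fun z => B.erase z) (t' := B), Finset.mul_sum]
    · refine Finset.sum_congr rfl fun z hz => ?_
      rw [← Finset.mul_sum]
      have : ∀ y ∈ B.erase z, (matchCount w s ((B.erase y).erase z) : ℤ) =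
          matchCount w s ((B.erase z).erase y) := by
        intro y _; rw [Finset.erase_right_comm]
      rw [Finset.sum_congr rfl this, ih, Finset.card_erase_of_mem hz, Finset.card_insert_of_notMem ha]
      have : 1 ≤ B.card := Finset.card_pos.2 ⟨z, hz⟩
      push_cast [this]
      ring
    · intro y z; simp only [Finset.mem_erase]; tauto

theorem matchCount_pos (w : X → Y → ℕ) {A : Finset X} {B : Finset Y} (f : X → Y)
    (hf : ∀ x ∈ A, f x ∈ B) (hinj : Set.InjOn f A) (hw : ∀ x ∈ A, w x (f x) ≠ 0) :
    0 < matchCount w A B := by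
  induction A using Finset.induction_on generalizing B with
  | empty => simp [matchCount_empty]
  | insert a s ha ih =>
    rw [matchCount_insert w ha]
    have h1 : 0 < matchCount w s (B.erase (f a)) := by
      refine ih (fun x hx => ?_) (hinj.mono (by simp)) fun x hx => hw x (by simp [hx])
      refine Finset.mem_erase.2 ⟨fun h => ?_, hf x (by simp [hx])⟩
      have := hinj (by simp [hx]) (by simp) h
      exact ha (this ▸ hx)
    refine lt_of_lt_of_le ?_ (Finset.single_le_sum (f := fun y => w a y * matchCount w s (B.erase y))
      (fun _ _ => Nat.zero_le _) (hf a (by simp)))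
    exact Nat.mul_pos (Nat.pos_of_ne_zero (hw a (by simp))) h1

/-- Adding the row `x₁` to the row `x₂` and deleting `x₁`. -/
def mergeRows (w : X → Y → ℕ) (x₁ x₂ : X) : X → Y → ℕ :=
  Function.update w x₂ (fun y => w x₁ y + w x₂ y)

/-- The permanent is linear in the merged row, which stands either for `x₁` (then `x₂` is missing)
or for `x₂` (then `x₁` is missing). -/
theorem matchCount_mergeRows (w : X → Y → ℕ) {A : Finset X} (B : Finset Y) {x₁ x₂ : X}
    (h₁ : x₁ ∈ A) (h₂ : x₂ ∈ A) (hne : x₁ ≠ x₂) :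
    matchCount (mergeRows w x₁ x₂) (A.erase x₁) B =
      matchCount w (A.erase x₁) B + matchCount w (A.erase x₂) B := by
  have h₂' : x₂ ∈ A.erase x₁ := Finset.mem_erase.2 ⟨hne.symm, h₂⟩
  have h₁' : x₁ ∈ A.erase x₂ := Finset.mem_erase.2 ⟨hne, h₁⟩
  rw [matchCount_row _ h₂', matchCount_row w h₂', matchCount_row w h₁', ← Finset.sum_add_distrib]
  refine Finset.sum_congr rfl fun y _ => ?_
  rw [Finset.erase_right_comm (a := x₂)]
  have : matchCount (mergeRows w x₁ x₂) ((A.erase x₁).erase x₂) (B.erase y) =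
      matchCount w ((A.erase x₁).erase x₂) (B.erase y) := by
    refine matchCount_congr fun x hx z _ => ?_
    simp only [mergeRows]
    rw [Function.update_of_ne (Finset.mem_erase.1 hx).1]
  rw [this]
  simp [mergeRows]
  ring

end Count

/-! ### Neighbourhoods, Hall's condition and crude lower bounds -/

section Bounds

variable {X Y : Type*}

/-- The columns of `B` with a nonzero entry in some row of `S`. -/
def colNbrs (w : X → Y → ℕ) (B : Finset Y) (S : Finset X) : Finset Y :=
  {y ∈ B | ∃ x ∈ S, w x y ≠ 0}

/-- The rows of `A` with a nonzero entry in the column `y`. -/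
def rowNbrs (w : X → Y → ℕ) (A : Finset X) (y : Y) : Finset X :=
  {x ∈ A | w x y ≠ 0}

theorem mem_colNbrs {w : X → Y → ℕ} {B : Finset Y} {S : Finset X} {y : Y} :
    y ∈ colNbrs w B S ↔ y ∈ B ∧ ∃ x ∈ S, w x y ≠ 0 := by
  simp [colNbrs]

theorem mem_rowNbrs {w : X → Y → ℕ} {A : Finset X} {x : X} {y : Y} :
    x ∈ rowNbrs w A y ↔ x ∈ A ∧ w x y ≠ 0 := by
  simp [rowNbrs]

theorem colNbrs_subset (w : X → Y → ℕ) (B : Finset Y) (S : Finset X) : colNbrs w B S ⊆ B :=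
  Finset.filter_subset _ _

theorem colNbrs_mono (w : X → Y → ℕ) (B : Finset Y) {S T : Finset X} (h : S ⊆ T) :
    colNbrs w B S ⊆ colNbrs w B T := by
  intro y hy
  obtain ⟨hB, x, hx, hw⟩ := mem_colNbrs.1 hy
  exact mem_colNbrs.2 ⟨hB, x, h hx, hw⟩

variable [DecidableEq X] [DecidableEq Y]

theorem colNbrs_union (w : X → Y → ℕ) (B : Finset Y) (S T : Finset X) :
    colNbrs w B (S ∪ T) = colNbrs w B S ∪ colNbrs w B T := by
  ext y
  simp only [mem_colNbrs, Finset.mem_union]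
  constructor
  · rintro ⟨hB, x, hx | hx, hw⟩
    · exact Or.inl ⟨hB, x, hx, hw⟩
    · exact Or.inr ⟨hB, x, hx, hw⟩
  · rintro (⟨hB, x, hx, hw⟩ | ⟨hB, x, hx, hw⟩)
    · exact ⟨hB, x, Or.inl hx, hw⟩
    · exact ⟨hB, x, Or.inr hx, hw⟩

theorem colNbrs_erase (w : X → Y → ℕ) (B : Finset Y) (S : Finset X) (y : Y) :
    colNbrs w (B.erase y) S = (colNbrs w B S).erase y := by
  ext z; simp only [mem_colNbrs, Finset.mem_erase]; tauto

theorem card_colNbrs_erase (w : X → Y → ℕ) (B : Finset Y) (S : Finset X) (y : Y) :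
    (colNbrs w B S).card ≤ (colNbrs w (B.erase y) S).card + 1 := by
  rw [colNbrs_erase]
  have := Finset.pred_card_le_card_erase (s := colNbrs w B S) (a := y)
  omega

/-- Hall's theorem: the marriage condition makes the number of matchings positive. -/
theorem matchCount_pos_of_hall (w : X → Y → ℕ) {A : Finset X} {B : Finset Y}
    (h : ∀ S ⊆ A, S.card ≤ (colNbrs w B S).card) : 0 < matchCount w A B := by
  rcases A.eq_empty_or_nonempty with rfl | ⟨a, ha⟩
  · simp [matchCount_empty]
  obtain ⟨f, hf, hf'⟩ := (Finset.all_card_le_biUnion_card_iff_exists_injective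
    (fun x : A => {y ∈ B | w x y ≠ 0})).1 (by
      intro s
      have h1 := h (s.map (Function.Embedding.subtype _)) (by
        intro x hx
        simp only [Finset.mem_map, Function.Embedding.subtype_apply] at hx
        obtain ⟨z, _, rfl⟩ := hx
        exact z.2)
      rw [Finset.card_map] at h1
      refine h1.trans (Finset.card_le_card fun y hy => ?_)
      obtain ⟨hB, x, hx, hw⟩ := mem_colNbrs.1 hy
      simp only [Finset.mem_map, Function.Embedding.subtype_apply] at hx
      obtain ⟨z, hz, rfl⟩ := hx
      simp only [Finset.mem_biUnion, Finset.mem_filter]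
      exact ⟨z, hz, hB, hw⟩)
  simp only [Finset.mem_filter] at hf'
  refine matchCount_pos w (fun x => if hx : x ∈ A then f ⟨x, hx⟩ else f ⟨a, ha⟩) ?_ ?_ ?_
  · intro x hx; simp only [hx, dif_pos]; exact (hf' _).1
  · intro x hx z hz hxz
    have hx : x ∈ A := hx
    have hz : z ∈ A := hz
    simp only [hx, hz, dif_pos] at hxz
    exact congrArg Subtype.val (hf hxz)
  · intro x hx; simp only [hx, dif_pos]; exact (hf' ⟨x, hx⟩).2

theorem matchCount_erase_pos {w : X → Y → ℕ} {A : Finset X} {B : Finset Y}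
    (h : 0 < matchCount w A B) {x : X} (hx : x ∈ A) : 0 < matchCount w (A.erase x) B := by
  rw [matchCount_row w hx] at h
  obtain ⟨y, _, hy⟩ := Finset.exists_ne_zero_of_sum_ne_zero h.ne'
  refine lt_of_lt_of_le (Nat.pos_of_ne_zero (right_ne_zero_of_mul hy)) (matchCount_mono w _ ?_)
  exact Finset.erase_subset _ _

theorem exists_matchCount_erase_pos {w : X → Y → ℕ} {A : Finset X} {B : Finset Y}
    (h : 0 < matchCount w A B) (hc : A.card < B.card) :
    ∃ y ∈ B, 0 < matchCount w A (B.erase y) := by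
  have h1 := sum_matchCount_erase w A B
  have h2 : ∑ y ∈ B, (matchCount w A (B.erase y) : ℤ) ≠ 0 := by
    rw [h1]
    have : (A.card : ℤ) < B.card := by exact_mod_cast hc
    exact mul_ne_zero (by omega) (by exact_mod_cast h.ne')
  obtain ⟨y, hy, h3⟩ := Finset.exists_ne_zero_of_sum_ne_zero h2
  exact ⟨y, hy, Nat.pos_of_ne_zero (by exact_mod_cast h3)⟩

/-- Pick a column avoidable by some matching. Induction counts the matchings avoiding it, and
rerouting one of its neighbours gives one more that uses it. -/
theorem excess_add_one_le_matchCount {w : X → Y → ℕ} {A : Finset X} {B : Finset Y} {t : ℕ}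
    (h : 0 < matchCount w A B) (hc : B.card = A.card + t)
    (hn : ∀ y ∈ B, ∃ x ∈ A, w x y ≠ 0) : t + 1 ≤ matchCount w A B := by
  induction t generalizing B with
  | zero => omega
  | succ t ih =>
    obtain ⟨y, hy, hpos⟩ := exists_matchCount_erase_pos h (by omega)
    have h1 := ih hpos (by rw [Finset.card_erase_of_mem hy]; omega)
      (fun z hz => hn z (Finset.mem_of_mem_erase hz))
    obtain ⟨x, hx, hw⟩ := hn y hy
    rw [matchCount_col w A hy]
    have h2 := Finset.single_le_sum
      (f := fun x => w x y * matchCount w (A.erase x) (B.erase y)) (fun _ _ => Nat.zero_le _) hx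
    have h3 : 0 < w x y * matchCount w (A.erase x) (B.erase y) :=
      Nat.mul_pos (Nat.pos_of_ne_zero hw) (matchCount_erase_pos hpos hx)
    omega

theorem two_terms_le_sum {ι : Type*} [DecidableEq ι] {s : Finset ι} {f : ι → ℕ} {a b : ι}
    (ha : a ∈ s) (hb : b ∈ s) (hab : a ≠ b) : f a + f b ≤ ∑ i ∈ s, f i := by
  rw [← Finset.sum_pair hab]
  exact Finset.sum_le_sum_of_subset (Finset.insert_subset ha (Finset.singleton_subset_iff.2 hb))

theorem sum_mergeRows (w : X → Y → ℕ) {A : Finset X} {x₁ x₂ : X}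
    (h₁ : x₁ ∈ A) (h₂ : x₂ ∈ A) (hne : x₁ ≠ x₂) (y : Y) :
    ∑ x ∈ A.erase x₁, mergeRows w x₁ x₂ x y = ∑ x ∈ A, w x y := by
  have h₂' : x₂ ∈ A.erase x₁ := Finset.mem_erase.2 ⟨hne.symm, h₂⟩
  rw [← Finset.add_sum_erase A _ h₁, ← Finset.add_sum_erase _ _ h₂',
    ← Finset.add_sum_erase _ (fun x => w x y) h₂']
  have : ∑ x ∈ (A.erase x₁).erase x₂, mergeRows w x₁ x₂ x y =
      ∑ x ∈ (A.erase x₁).erase x₂, w x y := by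
    refine Finset.sum_congr rfl fun x hx => ?_
    simp only [mergeRows]
    rw [Function.update_of_ne (Finset.mem_erase.1 hx).1]
  rw [this]
  simp [mergeRows, add_assoc]

/-- Induction by merging two rows that meet a used column. The hypothesis counts edges rather than
distinct neighbours because merging preserves only column sums. -/
theorem two_le_matchCount {w : X → Y → ℕ} {A : Finset X} {B : Finset Y}
    (h : 0 < matchCount w A B) (hA : A.Nonempty)
    (hn : ∀ y ∈ B, 2 ≤ ∑ x ∈ A, w x y) : 2 ≤ matchCount w A B := by
  induction hc : A.card generalizing w A B with
  | zero => exact absurd hc (Finset.card_ne_zero.2 hA)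
  | succ n ih =>
    obtain ⟨x, hx⟩ := hA
    have h' := h
    rw [matchCount_row w hx] at h'
    obtain ⟨y, hy, hxy⟩ := Finset.exists_ne_zero_of_sum_ne_zero h'.ne'
    have hw := Nat.pos_of_ne_zero (left_ne_zero_of_mul hxy)
    have hP := Nat.pos_of_ne_zero (right_ne_zero_of_mul hxy)
    rw [matchCount_col w A hy]
    by_cases hw2 : 2 ≤ w x y
    · have h2 := Finset.single_le_sum
        (f := fun x => w x y * matchCount w (A.erase x) (B.erase y)) (fun _ _ => Nat.zero_le _) hx
      have h3 : 2 * 1 ≤ w x y * matchCount w (A.erase x) (B.erase y) := Nat.mul_le_mul hw2 hP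
      omega
    · have hs := hn y hy
      rw [← Finset.add_sum_erase A _ hx] at hs
      obtain ⟨x', hx', hwx'⟩ := Finset.exists_ne_zero_of_sum_ne_zero
        (s := A.erase x) (f := fun x => w x y) (by omega)
      obtain ⟨hne, hxA'⟩ := Finset.mem_erase.1 hx'
      have h2 := two_terms_le_sum
        (f := fun x => w x y * matchCount w (A.erase x) (B.erase y)) hx hxA' hne.symm
      have h3 : matchCount w (A.erase x) (B.erase y) ≤ w x y * matchCount w (A.erase x) (B.erase y) :=
        Nat.le_mul_of_pos_left _ hw
      have h4 : matchCount w (A.erase x') (B.erase y) ≤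
          w x' y * matchCount w (A.erase x') (B.erase y) :=
        Nat.le_mul_of_pos_left _ (Nat.pos_of_ne_zero hwx')
      have h5 := matchCount_mergeRows w (B.erase y) hx hxA' hne.symm
      have h6 := ih (w := mergeRows w x x') (A := A.erase x) (B := B.erase y) (by omega) ⟨x', hx'⟩
        (fun z hz => by
          rw [sum_mergeRows w hx hxA' hne.symm]
          exact hn z (Finset.mem_of_mem_erase hz))
        (by rw [Finset.card_erase_of_mem hx]; omega)
      omega

theorem card_rowNbrs_le_sum (w : X → Y → ℕ) (A : Finset X) (y : Y) :
    (rowNbrs w A y).card ≤ ∑ x ∈ A, w x y := by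
  rw [Finset.card_eq_sum_ones]
  calc ∑ x ∈ rowNbrs w A y, 1 ≤ ∑ x ∈ rowNbrs w A y, w x y :=
        Finset.sum_le_sum fun x hx => Nat.pos_of_ne_zero (mem_rowNbrs.1 hx).2
    _ ≤ _ := Finset.sum_le_sum_of_subset (Finset.filter_subset _ _)

theorem exists_ne_of_two_le_card_rowNbrs {w : X → Y → ℕ} {A : Finset X} {y : Y}
    (h : 2 ≤ (rowNbrs w A y).card) (x : X) : ∃ x' ∈ A.erase x, w x' y ≠ 0 := by
  obtain ⟨x', hx', hne⟩ := Finset.exists_mem_ne h x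
  exact ⟨x', Finset.mem_erase.2 ⟨hne, (mem_rowNbrs.1 hx').1⟩, (mem_rowNbrs.1 hx').2⟩

/-- Raising the excess from t to t + 1 adds 2(t + 2) matchings: an avoidable column has two
neighbours, and assigning it to either leaves a problem of excess t + 1. -/
theorem quadratic_le_matchCount {w : X → Y → ℕ} {A : Finset X} {B : Finset Y} {t : ℕ}
    (h : 0 < matchCount w A B) (hA : A.Nonempty) (hc : B.card = A.card + t)
    (hn : ∀ y ∈ B, 2 ≤ (rowNbrs w A y).card) : (t + 1) * (t + 2) ≤ matchCount w A B := by
  induction t generalizing B with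
  | zero => exact two_le_matchCount h hA fun y hy => (hn y hy).trans (card_rowNbrs_le_sum w A y)
  | succ t ih =>
    obtain ⟨y, hy, hpos⟩ := exists_matchCount_erase_pos h (by omega)
    have h1 := ih hpos (by rw [Finset.card_erase_of_mem hy]; omega)
      (fun z hz => hn z (Finset.mem_of_mem_erase hz))
    obtain ⟨x₁, h₁, x₂, h₂, hne⟩ := Finset.one_lt_card.1 (hn y hy)
    rw [mem_rowNbrs] at h₁ h₂
    rw [matchCount_col w A hy]
    have key : ∀ x ∈ A, w x y ≠ 0 → t + 2 ≤ w x y * matchCount w (A.erase x) (B.erase y) := by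
      intro x hx hw
      refine le_trans ?_ (Nat.le_mul_of_pos_left _ (Nat.pos_of_ne_zero hw))
      refine excess_add_one_le_matchCount (matchCount_erase_pos hpos hx) ?_ ?_
      · rw [Finset.card_erase_of_mem hy, Finset.card_erase_of_mem hx]
        have := Finset.card_pos.2 ⟨x, hx⟩
        omega
      · intro z hz
        exact exists_ne_of_two_le_card_rowNbrs (hn z (Finset.mem_of_mem_erase hz)) x
    have h2 := two_terms_le_sum
        (f := fun x => w x y * matchCount w (A.erase x) (B.erase y)) h₁.1 h₂.1 hne
    have h3 := key x₁ h₁.1 h₁.2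
    have h4 := key x₂ h₂.1 h₂.2
    nlinarith

/-- Every column is avoidable, and with excess u + 1 each is avoided by at least u + 1 matchings.
Each matching leaves u + 1 columns free, so the factor cancels. -/
theorem card_le_matchCount {w : X → Y → ℕ} {A : Finset X} {B : Finset Y} (hA : A.Nonempty)
    (hs : ∀ S ⊆ A, S.Nonempty → S.card < (colNbrs w B S).card)
    (hn : ∀ y ∈ B, ∃ x ∈ A, w x y ≠ 0) : B.card ≤ matchCount w A B := by
  have hlt : A.card < B.card :=
    (hs A subset_rfl hA).trans_le (Finset.card_le_card (colNbrs_subset _ _ _))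
  obtain ⟨u, hu⟩ := Nat.exists_eq_add_of_lt hlt
  have h1 : ∀ y ∈ B, ((u : ℤ) + 1) ≤ matchCount w A (B.erase y) := by
    intro y hy
    have := excess_add_one_le_matchCount (w := w) (A := A) (B := B.erase y) (t := u)
      (matchCount_pos_of_hall w fun S hS => by
        rcases S.eq_empty_or_nonempty with rfl | hne
        · simp
        · have := hs S hS hne
          have := card_colNbrs_erase w B S y
          omega)
      (by rw [Finset.card_erase_of_mem hy]; omega)
      (fun z hz => hn z (Finset.mem_of_mem_erase hz))
    exact_mod_cast this
  have h2 := Finset.sum_le_sum h1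
  rw [sum_matchCount_erase, Finset.sum_const, nsmul_eq_mul] at h2
  have h3 : ((B.card : ℤ) - A.card) = u + 1 := by rw [hu]; push_cast; ring
  rw [h3, mul_comm] at h2
  exact_mod_cast le_of_mul_le_mul_left h2 (by positivity)

end Bounds

/-! ### Surplus matrices and edges that cannot be removed -/

section Structure

variable {X Y : Type*} [DecidableEq X] [DecidableEq Y]

/-- The submatrix of `w` with rows `A` and columns `B` is the multiplicity matrix of a leafless
bipartite multigraph in which proper sets of rows have surplus. -/
structure IsSurplusLeafless (w : X → Y → ℕ) (A : Finset X) (B : Finset Y) : Prop where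
  two_le : 2 ≤ A.card
  card_le : A.card ≤ B.card
  surplus : ∀ S ⊆ A, S.Nonempty → S ≠ A → S.card < (colNbrs w B S).card
  leafless : ∀ y ∈ B, 2 ≤ (rowNbrs w A y).card

/-- A proper set of rows with exactly one more neighbour than elements. -/
structure IsTight (w : X → Y → ℕ) (A : Finset X) (B : Finset Y) (S : Finset X) : Prop where
  subset : S ⊆ A
  ne : S ≠ A
  card_eq : (colNbrs w B S).card = S.card + 1

/-- A tight set certifying that the surplus property needs the entry `(x, y)`. -/
structure IsWitness (w : X → Y → ℕ) (A : Finset X) (B : Finset Y) (x : X) (y : Y)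
    (S : Finset X) : Prop extends IsTight w A B S where
  mem : x ∈ S
  eq_of_mem : ∀ z ∈ S, w z y ≠ 0 → z = x

/-- The matrix `w` with the entry `(x, y)` lowered by one. -/
def lowerEntry (w : X → Y → ℕ) (x : X) (y : Y) : X → Y → ℕ :=
  fun z v => if z = x ∧ v = y then w z v - 1 else w z v

theorem lowerEntry_of_ne (w : X → Y → ℕ) {x z : X} {y v : Y} (h : ¬ (z = x ∧ v = y)) :
    lowerEntry w x y z v = w z v := by
  simp [lowerEntry, h]

theorem lowerEntry_self (w : X → Y → ℕ) (x : X) (y : Y) :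
    lowerEntry w x y x y = w x y - 1 := by
  simp [lowerEntry]

theorem colNbrs_congr {w w' : X → Y → ℕ} {B : Finset Y} {S : Finset X}
    (h : ∀ x ∈ S, ∀ y ∈ B, w x y ≠ 0 ↔ w' x y ≠ 0) : colNbrs w B S = colNbrs w' B S := by
  ext y
  simp only [mem_colNbrs]
  constructor
  · rintro ⟨hB, x, hx, hw⟩; exact ⟨hB, x, hx, (h x hx y hB).1 hw⟩
  · rintro ⟨hB, x, hx, hw⟩; exact ⟨hB, x, hx, (h x hx y hB).2 hw⟩

theorem rowNbrs_congr {w w' : X → Y → ℕ} {A : Finset X} {y : Y}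
    (h : ∀ x ∈ A, w x y ≠ 0 ↔ w' x y ≠ 0) : rowNbrs w A y = rowNbrs w' A y := by
  ext x
  simp only [mem_rowNbrs]
  constructor
  · rintro ⟨hA, hw⟩; exact ⟨hA, (h x hA).1 hw⟩
  · rintro ⟨hA, hw⟩; exact ⟨hA, (h x hA).2 hw⟩

namespace IsSurplusLeafless

variable {w : X → Y → ℕ} {A : Finset X} {B : Finset Y}

theorem colNbrs_eq (h : IsSurplusLeafless w A B) : colNbrs w B A = B := by
  refine Finset.Subset.antisymm (colNbrs_subset _ _ _) fun y hy => ?_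
  obtain ⟨x, hx⟩ := Finset.card_pos.1 (lt_of_lt_of_le Nat.zero_lt_two (h.leafless y hy))
  exact mem_colNbrs.2 ⟨hy, x, mem_rowNbrs.1 hx⟩

theorem surplus_of_lt (h : IsSurplusLeafless w A B) (hlt : A.card < B.card) {S : Finset X}
    (hS : S ⊆ A) (hne : S.Nonempty) : S.card < (colNbrs w B S).card := by
  by_cases hSA : S = A
  · rw [hSA, h.colNbrs_eq]; exact hlt
  · exact h.surplus S hS hne hSA

theorem hall (h : IsSurplusLeafless w A B) {S : Finset X} (hS : S ⊆ A) :
    S.card ≤ (colNbrs w B S).card := by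
  by_cases hSA : S = A
  · rw [hSA, h.colNbrs_eq]; exact h.card_le
  · rcases S.eq_empty_or_nonempty with rfl | hne
    · simp
    · exact (h.surplus S hS hne hSA).le

theorem singleton_ne (h : IsSurplusLeafless w A B) (x : X) : {x} ≠ A := by
  rintro rfl
  have := h.two_le
  simp at this

theorem two_le_card_colNbrs (h : IsSurplusLeafless w A B) {x : X} (hx : x ∈ A) :
    2 ≤ (colNbrs w B {x}).card := by
  have := h.surplus {x} (Finset.singleton_subset_iff.2 hx) (Finset.singleton_nonempty x)
    (h.singleton_ne x)
  rw [Finset.card_singleton] at this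
  exact this

/-- If an entry cannot be lowered, then it is at most one, and it is needed for the column to
have two neighbours or for some set of rows to have surplus. -/
theorem critical (h : IsSurplusLeafless w A B) {x : X} {y : Y} (hy : y ∈ B)
    (hw : w x y ≠ 0) (hcrit : ¬ IsSurplusLeafless (lowerEntry w x y) A B) :
    w x y = 1 ∧ ((rowNbrs w A y).card = 2 ∨ ∃ S, IsWitness w A B x y S) := by
  have h1 : w x y = 1 := by
    have hpos := Nat.pos_of_ne_zero hw
    by_contra hne
    apply hcrit
    have hsupp : ∀ z v, lowerEntry w x y z v ≠ 0 ↔ w z v ≠ 0 := by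
      intro z v
      by_cases hzv : z = x ∧ v = y
      · rw [hzv.1, hzv.2, lowerEntry_self]; omega
      · rw [lowerEntry_of_ne w hzv]
    refine ⟨h.two_le, h.card_le, fun S hS hn hSA => ?_, fun v hv => ?_⟩
    · rw [colNbrs_congr fun z _ v _ => hsupp z v]; exact h.surplus S hS hn hSA
    · rw [rowNbrs_congr fun z _ => hsupp z v]; exact h.leafless v hv
  refine ⟨h1, ?_⟩
  by_contra hcon
  push Not at hcon
  obtain ⟨h2, h3⟩ := hcon
  apply hcrit
  refine ⟨h.two_le, h.card_le, fun S hS hn hSA => ?_, fun v hv => ?_⟩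
  · by_cases hex : x ∈ S ∧ ∀ z ∈ S, w z y ≠ 0 → z = x
    · have hlt := h.surplus S hS hn hSA
      have hne : (colNbrs w B S).card ≠ S.card + 1 := fun hc => h3 S ⟨⟨hS, hSA, hc⟩, hex.1, hex.2⟩
      -- Lowering the entry costs `S` at most the column `y`, which a set that is not tight can
      -- afford.
      have hsub : (colNbrs w B S).erase y ⊆ colNbrs (lowerEntry w x y) B S := by
        intro v hv
        obtain ⟨hvy, hv⟩ := Finset.mem_erase.1 hv
        obtain ⟨hB, z, hz, hwz⟩ := mem_colNbrs.1 hv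
        refine mem_colNbrs.2 ⟨hB, z, hz, ?_⟩
        rwa [lowerEntry_of_ne w fun hh => hvy hh.2]
      have h4 := Finset.card_le_card hsub
      have h5 := Finset.pred_card_le_card_erase (s := colNbrs w B S) (a := y)
      omega
    · refine (h.surplus S hS hn hSA).trans_le (Finset.card_le_card fun v hv => ?_)
      obtain ⟨hB, z, hz, hwz⟩ := mem_colNbrs.1 hv
      by_cases hzv : z = x ∧ v = y
      · have : ∃ z ∈ S, w z y ≠ 0 ∧ z ≠ x := by
          by_contra hno
          push Not at hno
          exact hex ⟨hzv.1 ▸ hz, hno⟩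
        obtain ⟨u, hu, hwu, hux⟩ := this
        refine mem_colNbrs.2 ⟨hB, u, hu, ?_⟩
        rw [lowerEntry_of_ne w fun hh => hux hh.1, hzv.2]
        exact hwu
      · refine mem_colNbrs.2 ⟨hB, z, hz, ?_⟩
        rwa [lowerEntry_of_ne w hzv]
  · have hsub : ∀ z ∈ rowNbrs w A v, z ≠ x ∨ v ≠ y → z ∈ rowNbrs (lowerEntry w x y) A v := by
      intro z hz hne
      obtain ⟨hA, hwz⟩ := mem_rowNbrs.1 hz
      refine mem_rowNbrs.2 ⟨hA, ?_⟩
      rwa [lowerEntry_of_ne w (by tauto)]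
    by_cases hvy : v = y
    · have h4 : (rowNbrs w A y).erase x ⊆ rowNbrs (lowerEntry w x y) A v := by
        intro z hz
        obtain ⟨hzx, hz⟩ := Finset.mem_erase.1 hz
        exact hsub z (hvy ▸ hz) (Or.inl hzx)
      have h5 := Finset.card_le_card h4
      have h6 := Finset.pred_card_le_card_erase (s := rowNbrs w A y) (a := x)
      have h7 := h.leafless y hy
      omega
    · exact (h.leafless v hv).trans (Finset.card_le_card fun z hz => hsub z hz (Or.inr hvy))

end IsSurplusLeafless

theorem colNbrs_inter_subset (w : X → Y → ℕ) (B : Finset Y) (S T : Finset X) :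
    colNbrs w B (S ∩ T) ⊆ colNbrs w B S ∩ colNbrs w B T :=
  Finset.subset_inter (colNbrs_mono w B Finset.inter_subset_left)
    (colNbrs_mono w B Finset.inter_subset_right)

theorem card_colNbrs_union (w : X → Y → ℕ) (B : Finset Y) (S T : Finset X) :
    (colNbrs w B (S ∪ T)).card + (colNbrs w B S ∩ colNbrs w B T).card =
      (colNbrs w B S).card + (colNbrs w B T).card := by
  rw [colNbrs_union, Finset.card_union_add_card_inter]

/-! ### Uncrossing tight sets: an irreducible matrix has a column of degree two -/

section Tight

variable {w : X → Y → ℕ} {A : Finset X} {B : Finset Y}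

/-- Submodularity of |N(S)| - |S|: the two values sum to 2, while intersection and union each have
value at least 1. -/
theorem IsTight.uncross (h : IsSurplusLeafless w A B) {S T : Finset X} (hS : IsTight w A B S)
    (hT : IsTight w A B T) (hne : (S ∩ T).Nonempty)
    (hu : (S ∪ T).card < (colNbrs w B (S ∪ T)).card) :
    IsTight w A B (S ∩ T) ∧ (colNbrs w B (S ∪ T)).card = (S ∪ T).card + 1 := by
  have h1 := card_colNbrs_union w B S T
  have h2 := Finset.card_le_card (colNbrs_inter_subset w B S T)
  have h3 := Finset.card_union_add_card_inter S T
  have hsub : S ∩ T ⊆ A := Finset.inter_subset_left.trans hS.subset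
  have hneA : S ∩ T ≠ A := fun he =>
    hS.ne (Finset.Subset.antisymm hS.subset (he ▸ Finset.inter_subset_left))
  have h4 := h.surplus _ hsub hne hneA
  have h5 := hS.card_eq
  have h6 := hT.card_eq
  exact ⟨⟨hsub, hneA, by omega⟩, by omega⟩

/-- A smallest tight set `S₀` around `x` lies inside every witness for an edge at `x`, by
uncrossing. So the d neighbours of `x` are lost to `S₀.erase x`, which keeps at most |S₀| + 1 - d
columns. As d ≥ 2, surplus forces `S₀ = {x}` and d = 2. -/
theorem card_colNbrs_singleton_eq_two (h : IsSurplusLeafless w A B) {x : X} (hx : x ∈ A)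
    {S₀ : Finset X} (h₀ : IsTight w A B S₀) (hx₀ : x ∈ S₀)
    (hmin : ∀ S, IsTight w A B S → x ∈ S → S₀.card ≤ S.card)
    (hW : ∀ y ∈ B, w x y ≠ 0 → ∃ S, IsWitness w A B x y S ∧ (A.card < B.card ∨ S₀ ∪ S ≠ A)) :
    (colNbrs w B {x}).card = 2 := by
  have huniq : ∀ y ∈ B, w x y ≠ 0 → ∀ z ∈ S₀, w z y ≠ 0 → z = x := by
    intro y hy hw z hz hwz
    obtain ⟨S, hS, hor⟩ := hW y hy hw
    have hsub : S₀ ∪ S ⊆ A := Finset.union_subset h₀.subset hS.subset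
    have hne : (S₀ ∪ S).Nonempty := ⟨x, Finset.mem_union_left _ hx₀⟩
    have hlt : (S₀ ∪ S).card < (colNbrs w B (S₀ ∪ S)).card := by
      rcases hor with hor | hor
      · exact h.surplus_of_lt hor hsub hne
      · exact h.surplus _ hsub hne hor
    have hxi : x ∈ S₀ ∩ S := Finset.mem_inter.2 ⟨hx₀, hS.mem⟩
    have ht := (IsTight.uncross h h₀ hS.toIsTight ⟨x, hxi⟩ hlt).1
    have heq := Finset.eq_of_subset_of_card_le Finset.inter_subset_left (hmin _ ht hxi)
    have hzi : z ∈ S₀ ∩ S := heq.symm ▸ hz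
    exact hS.eq_of_mem z (Finset.mem_inter.1 hzi).2 hwz
  have hd := h.two_le_card_colNbrs hx
  have hsub : colNbrs w B (S₀.erase x) ⊆ colNbrs w B S₀ \ colNbrs w B {x} := by
    intro y hy
    obtain ⟨hB, z, hz, hwz⟩ := mem_colNbrs.1 hy
    obtain ⟨hzx, hz⟩ := Finset.mem_erase.1 hz
    refine Finset.mem_sdiff.2 ⟨mem_colNbrs.2 ⟨hB, z, hz, hwz⟩, fun hyx => ?_⟩
    obtain ⟨_, x', hx', hwx⟩ := mem_colNbrs.1 hyx
    rw [Finset.mem_singleton.1 hx'] at hwx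
    exact hzx (huniq y hB hwx z hz hwz)
  have hc := Finset.card_le_card hsub
  have hxs : colNbrs w B {x} ⊆ colNbrs w B S₀ :=
    colNbrs_mono w B (Finset.singleton_subset_iff.2 hx₀)
  rw [Finset.card_sdiff_of_subset hxs, h₀.card_eq] at hc
  have hce := Finset.card_erase_of_mem hx₀
  have hcl := Finset.card_le_card hxs
  rw [h₀.card_eq] at hcl
  have hpos := Finset.card_pos.2 ⟨x, hx₀⟩
  rcases (S₀.erase x).eq_empty_or_nonempty with he | hne
  · rw [he, Finset.card_empty] at hce
    omega
  · have := h.surplus (S₀.erase x) ((Finset.erase_subset _ _).trans h₀.subset) hne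
      (fun he => Finset.notMem_erase x S₀ (he ▸ hx))
    omega

theorem exists_minimal_isTight {x : X} {S : Finset X} (hS : IsTight w A B S) (hx : x ∈ S) :
    ∃ S₀, IsTight w A B S₀ ∧ x ∈ S₀ ∧ ∀ S, IsTight w A B S → x ∈ S → S₀.card ≤ S.card := by
  classical
  obtain ⟨S₀, h₀, hmin⟩ := Finset.exists_min_image
    (A.powerset.filter fun S => IsTight w A B S ∧ x ∈ S) Finset.card
    ⟨S, by simp [hS, hx, hS.subset]⟩
  simp only [Finset.mem_filter, Finset.mem_powerset] at h₀ hmin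
  exact ⟨S₀, h₀.2.1, h₀.2.2, fun S hS hx => hmin S ⟨hS.subset, hS, hx⟩⟩

theorem sum_card_colNbrs_singleton (w : X → Y → ℕ) (A : Finset X) (B : Finset Y) :
    ∑ x ∈ A, (colNbrs w B {x}).card = ∑ y ∈ B, (rowNbrs w A y).card := by
  have := Finset.sum_card_bipartiteAbove_eq_sum_card_bipartiteBelow (s := A) (t := B)
    (fun x y => w x y ≠ 0)
  simpa [Finset.bipartiteAbove, Finset.bipartiteBelow, colNbrs, rowNbrs] using this

/-- Otherwise every edge has a witness, so all rows have degree two. With more columns than rows,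
some column would have degree below two. -/
theorem exists_card_rowNbrs_eq_two_of_lt (h : IsSurplusLeafless w A B) (hlt : A.card < B.card)
    (hW : ∀ x ∈ A, ∀ y ∈ B, w x y ≠ 0 →
      (rowNbrs w A y).card = 2 ∨ ∃ S, IsWitness w A B x y S) :
    ∃ y ∈ B, (rowNbrs w A y).card = 2 := by
  by_contra hno
  push Not at hno
  have hdeg : ∀ x ∈ A, (colNbrs w B {x}).card = 2 := by
    intro x hx
    obtain ⟨y, hy⟩ := Finset.card_pos.1 (lt_of_lt_of_le Nat.zero_lt_two (h.two_le_card_colNbrs hx))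
    obtain ⟨hyB, x', hx', hw⟩ := mem_colNbrs.1 hy
    rw [Finset.mem_singleton.1 hx'] at hw
    obtain ⟨S, hS⟩ := (hW x hx y hyB hw).resolve_left (hno y hyB)
    obtain ⟨S₀, h₀, hx₀, hmin⟩ := exists_minimal_isTight hS.toIsTight hS.mem
    refine card_colNbrs_singleton_eq_two h hx h₀ hx₀ hmin fun y hy hw => ?_
    obtain ⟨S, hS⟩ := (hW x hx y hy hw).resolve_left (hno y hy)
    exact ⟨S, hS, Or.inl hlt⟩
  have h1 := sum_card_colNbrs_singleton w A B
  rw [Finset.sum_congr rfl hdeg] at h1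
  have h2 : ∑ y ∈ B, 2 ≤ ∑ y ∈ B, (rowNbrs w A y).card := Finset.sum_le_sum h.leafless
  rw [← h1] at h2
  simp at h2
  omega

/-- In the square case the full row set has no surplus, so tight sets may be uncrossed only when
their union is proper. A largest witness `S` ensures this for rows adjacent to columns outside N(S),
and the degree count is done there. -/
theorem exists_card_rowNbrs_eq_two_of_card_eq (h : IsSurplusLeafless w A B)
    (heq : A.card = B.card)
    (hW : ∀ x ∈ A, ∀ y ∈ B, w x y ≠ 0 →
      (rowNbrs w A y).card = 2 ∨ ∃ S, IsWitness w A B x y S) :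
    ∃ y ∈ B, (rowNbrs w A y).card = 2 := by
  classical
  by_contra hno
  push Not at hno
  have hthree : ∀ y ∈ B, 3 ≤ (rowNbrs w A y).card := by
    intro y hy
    have h1 := h.leafless y hy
    have h2 := hno y hy
    omega
  replace hW : ∀ x ∈ A, ∀ y ∈ B, w x y ≠ 0 → ∃ S, IsWitness w A B x y S :=
    fun x hx y hy hw => (hW x hx y hy hw).resolve_left (hno y hy)
  obtain ⟨S, hSP, hmax⟩ := Finset.exists_max_image
    (A.powerset.filter fun S => ∃ x ∈ A, ∃ y ∈ B, w x y ≠ 0 ∧ IsWitness w A B x y S) Finset.card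
    (by
      obtain ⟨y, hy⟩ := Finset.card_pos.1 (lt_of_lt_of_le (by have := h.two_le; omega) h.card_le)
      obtain ⟨x, hx⟩ := Finset.card_pos.1 (lt_of_lt_of_le Nat.zero_lt_two (h.leafless y hy))
      obtain ⟨hxA, hw⟩ := mem_rowNbrs.1 hx
      obtain ⟨S, hS⟩ := hW x hxA y hy hw
      exact ⟨S, by
        simp only [Finset.mem_filter, Finset.mem_powerset]
        exact ⟨hS.subset, x, hxA, y, hy, hw, hS⟩⟩)
  simp only [Finset.mem_filter, Finset.mem_powerset] at hSP hmax
  obtain ⟨hSA, x, hx, y, hy, hw, hS⟩ := hSP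
  replace hmax : ∀ x ∈ A, ∀ y ∈ B, w x y ≠ 0 → ∀ S', IsWitness w A B x y S' → S'.card ≤ S.card :=
    fun x hx y hy hw S' hS' => hmax S' ⟨hS'.subset, x, hx, y, hy, hw, hS'⟩
  have hScard := hS.card_eq
  have hC : (A \ S).card = A.card - S.card := Finset.card_sdiff_of_subset hSA
  have hSlt : S.card < A.card :=
    Finset.card_lt_card ((Finset.ssubset_iff_subset_ne).2 ⟨hSA, hS.ne⟩)
  -- `y` has degree at least three and meets `S` only in `x`.
  have hC2 : 2 ≤ (A \ S).card := by
    have hsub : rowNbrs w A y ⊆ insert x (A \ S) := by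
      intro z hz
      obtain ⟨hzA, hwz⟩ := mem_rowNbrs.1 hz
      by_cases hzS : z ∈ S
      · simp [hS.eq_of_mem z hzS hwz]
      · simp [hzA, hzS]
    have h1 := Finset.card_le_card hsub
    have h2 := Finset.card_insert_le x (A \ S)
    have h3 := hthree y hy
    omega
  have hT : (B \ colNbrs w B S).card = B.card - (S.card + 1) := by
    rw [Finset.card_sdiff_of_subset (colNbrs_subset _ _ _), hScard]
  have hnotS : ∀ z, ∀ v ∈ B \ colNbrs w B S, w z v ≠ 0 → z ∉ S := by
    intro z v hv hwz hz
    obtain ⟨hvB, hv⟩ := Finset.mem_sdiff.1 hv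
    exact hv (mem_colNbrs.2 ⟨hvB, z, hz, hwz⟩)
  have hdeg : ∀ x' ∈ A, ∀ y' ∈ B \ colNbrs w B S, w x' y' ≠ 0 →
      (colNbrs w B {x'}).card = 2 := by
    intro x' hx' y' hy' hw'
    have hyB' := (Finset.mem_sdiff.1 hy').1
    have hxS' := hnotS x' y' hy' hw'
    obtain ⟨S', hS'⟩ := hW x' hx' y' hyB' hw'
    -- If they met, the union would be a larger witness for the same edge. It is proper because a
    -- second neighbour of `y'` lies in neither set.
    have hdisj : S ∩ S' = ∅ := by
      by_contra hne
      have hne := Finset.nonempty_iff_ne_empty.2 hne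
      have hsub : S ∪ S' ⊆ A := Finset.union_subset hSA hS'.subset
      have hneA : S ∪ S' ≠ A := by
        obtain ⟨x'', hx'', hw''⟩ := exists_ne_of_two_le_card_rowNbrs (h.leafless y' hyB') x'
        obtain ⟨hne', hxA''⟩ := Finset.mem_erase.1 hx''
        intro he
        rw [← he] at hxA''
        rcases Finset.mem_union.1 hxA'' with hm | hm
        · exact hnotS x'' y' hy' hw'' hm
        · exact hne' (hS'.eq_of_mem x'' hm hw'')
      have hlt := h.surplus _ hsub ⟨x, Finset.mem_union_left _ hS.mem⟩ hneA
      have hu := (IsTight.uncross h hS.toIsTight hS'.toIsTight hne hlt).2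
      have hwit : IsWitness w A B x' y' (S ∪ S') :=
        ⟨⟨hsub, hneA, hu⟩, Finset.mem_union_right _ hS'.mem, fun z hz hwz => by
          rcases Finset.mem_union.1 hz with hm | hm
          · exact absurd hm (hnotS z y' hy' hwz)
          · exact hS'.eq_of_mem z hm hwz⟩
      have h1 := hmax x' hx' y' hyB' hw' _ hwit
      have h2 : insert x' S ⊆ S ∪ S' :=
        Finset.insert_subset (Finset.mem_union_right _ hS'.mem) Finset.subset_union_left
      have h3 := Finset.card_le_card h2
      rw [Finset.card_insert_of_notMem hxS'] at h3
      omega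
    have hS'card : S'.card ≤ (A \ S).card := by
      refine Finset.card_le_card fun z hz => Finset.mem_sdiff.2 ⟨hS'.subset hz, fun hzS => ?_⟩
      have : z ∈ S ∩ S' := Finset.mem_inter.2 ⟨hzS, hz⟩
      rw [hdisj] at this
      simp at this
    obtain ⟨S₀, h₀, hx₀, hmin⟩ := exists_minimal_isTight hS'.toIsTight hS'.mem
    refine card_colNbrs_singleton_eq_two h hx' h₀ hx₀ hmin fun y'' hy'' hw'' => ?_
    obtain ⟨S'', hS''⟩ := hW x' hx' y'' hy'' hw''
    -- |S₀| ≤ |S'| ≤ |A| - |S| and |S''| ≤ |S|; since both sets contain `x'`, they cannot cover `A`.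
    refine ⟨S'', hS'', Or.inr fun he => ?_⟩
    have h1 := Finset.card_union_add_card_inter S₀ S''
    have h2 : 0 < (S₀ ∩ S'').card := Finset.card_pos.2 ⟨x', Finset.mem_inter.2 ⟨hx₀, hS''.mem⟩⟩
    have h3 := hmin S' hS'.toIsTight hS'.mem
    have h4 := hmax x' hx' y'' hy'' hw'' S'' hS''
    rw [he] at h1
    omega
  set T := B \ colNbrs w B S with hTdef
  set C₁ := A.filter fun x => ∃ y ∈ T, w x y ≠ 0 with hC₁def
  have hTB : T ⊆ B := Finset.sdiff_subset
  have hC₁A : C₁ ⊆ A := Finset.filter_subset _ _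
  have hC₁C : C₁ ⊆ A \ S := by
    intro z hz
    obtain ⟨hzA, v, hv, hwz⟩ := Finset.mem_filter.1 hz
    exact Finset.mem_sdiff.2 ⟨hzA, hnotS z v hv hwz⟩
  have hrow : ∀ v ∈ T, rowNbrs w C₁ v = rowNbrs w A v := by
    intro v hv
    ext z
    simp only [mem_rowNbrs, hC₁def, Finset.mem_filter]
    constructor
    · rintro ⟨⟨hzA, _⟩, hwz⟩; exact ⟨hzA, hwz⟩
    · rintro ⟨hzA, hwz⟩; exact ⟨⟨hzA, v, hv, hwz⟩, hwz⟩
  have hTD : T ⊆ colNbrs w B C₁ := by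
    intro v hv
    obtain ⟨z, hz⟩ := Finset.card_pos.1
      (lt_of_lt_of_le Nat.zero_lt_two (h.leafless v (hTB hv)))
    rw [← hrow v hv] at hz
    exact mem_colNbrs.2 ⟨hTB hv, z, mem_rowNbrs.1 hz⟩
  have hTne : T.Nonempty := Finset.card_pos.1 (by omega)
  have hC₁ne : C₁.Nonempty := by
    obtain ⟨v, hv⟩ := hTne
    obtain ⟨_, z, hz, _⟩ := mem_colNbrs.1 (hTD hv)
    exact ⟨z, hz⟩
  have hC₁neA : C₁ ≠ A := by
    intro he
    have hxC : x ∈ C₁ := he ▸ hx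
    exact (Finset.mem_sdiff.1 (hC₁C hxC)).2 hS.mem
  have hsur := h.surplus C₁ hC₁A hC₁ne hC₁neA
  -- Counting edges at `C₁`: 2|C₁| ≥ 3|T| + (|N(C₁)| - |T|) ≥ 2|T| + |C₁| + 1. With |T| = |A \ S| -
  -- 1 and |C₁| ≤ |A \ S| this contradicts |A \ S| ≥ 2.
  have hcount := sum_card_colNbrs_singleton w C₁ (colNbrs w B C₁)
  have hleft : ∀ z ∈ C₁, (colNbrs w (colNbrs w B C₁) {z}).card = 2 := by
    intro z hz
    obtain ⟨hzA, v, hv, hwz⟩ := Finset.mem_filter.1 hz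
    rw [← hdeg z hzA v hv hwz]
    congr 1
    ext u
    simp only [mem_colNbrs, Finset.mem_singleton, exists_eq_left]
    constructor
    · rintro ⟨⟨hB, _⟩, hwu⟩; exact ⟨hB, hwu⟩
    · rintro ⟨hB, hwu⟩; exact ⟨⟨hB, z, hz, hwu⟩, hwu⟩
  rw [Finset.sum_congr rfl hleft, ← Finset.sum_sdiff hTD] at hcount
  have hr1 : ∑ v ∈ T, 3 ≤ ∑ v ∈ T, (rowNbrs w C₁ v).card := by
    refine Finset.sum_le_sum fun v hv => ?_
    rw [hrow v hv]; exact hthree v (hTB hv)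
  have hr2 : ∑ v ∈ colNbrs w B C₁ \ T, 1 ≤ ∑ v ∈ colNbrs w B C₁ \ T, (rowNbrs w C₁ v).card := by
    refine Finset.sum_le_sum fun v hv => ?_
    obtain ⟨_, z, hz, hwz⟩ := mem_colNbrs.1 (Finset.mem_sdiff.1 hv).1
    exact Finset.card_pos.2 ⟨z, mem_rowNbrs.2 ⟨hz, hwz⟩⟩
  have hcC := Finset.card_le_card hC₁C
  have hcT := Finset.card_le_card hTD
  simp only [Finset.sum_const, smul_eq_mul, mul_one, Finset.card_sdiff_of_subset hTD]
    at hcount hr1 hr2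
  omega

theorem exists_card_rowNbrs_eq_two (h : IsSurplusLeafless w A B)
    (hW : ∀ x ∈ A, ∀ y ∈ B, w x y ≠ 0 →
      (rowNbrs w A y).card = 2 ∨ ∃ S, IsWitness w A B x y S) :
    ∃ y ∈ B, (rowNbrs w A y).card = 2 :=
  h.card_le.lt_or_eq.elim (fun hlt => exists_card_rowNbrs_eq_two_of_lt h hlt hW)
    fun heq => exists_card_rowNbrs_eq_two_of_card_eq h heq hW

end Tight

end Structure

/-! ### Induction steps: removing an edge, two rows, merging twins -/

section LowerBound

variable {X Y : Type*} [DecidableEq X] [DecidableEq Y]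

/-- The sum of the entries of `w` in the rows `A` and the columns `B`. -/
def total (w : X → Y → ℕ) (A : Finset X) (B : Finset Y) : ℕ :=
  ∑ y ∈ B, ∑ x ∈ A, w x y

/-- The lower bound for the number of matchings, with `m + 2` rows, `m + 2 + t` columns
and `2 * (m + 2 + t) + b` edges. -/
def BoundHolds (w : X → Y → ℕ) (A : Finset X) (B : Finset Y) : Prop :=
  ∀ m t b : ℕ, A.card = m + 2 → B.card = m + 2 + t → total w A B = 2 * (m + 2 + t) + b →
    ((m + 1) * t + 2 + b) * (t + 1) ≤ matchCount w A B

/-- The columns of `B` whose neighbours are exactly `u` and `v`. -/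
def twins (w : X → Y → ℕ) (A : Finset X) (B : Finset Y) (u v : X) : Finset Y :=
  {y ∈ B | rowNbrs w A y = {u, v}}

variable {w : X → Y → ℕ} {A : Finset X} {B : Finset Y} {u v : X}

theorem mem_twins {y : Y} : y ∈ twins w A B u v ↔ y ∈ B ∧ rowNbrs w A y = {u, v} := by
  simp [twins]

theorem twins_comm (w : X → Y → ℕ) (A : Finset X) (B : Finset Y) (u v : X) :
    twins w A B u v = twins w A B v u := by
  simp only [twins, Finset.pair_comm]

theorem twins_subset (w : X → Y → ℕ) (A : Finset X) (B : Finset Y) (u v : X) :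
    twins w A B u v ⊆ B :=
  Finset.filter_subset _ _

theorem ne_zero_iff_of_mem_twins {x : X} {y : Y} (hy : y ∈ twins w A B u v) (hx : x ∈ A) :
    w x y ≠ 0 ↔ x = u ∨ x = v := by
  have h := (mem_twins.1 hy).2
  have : x ∈ rowNbrs w A y ↔ x ∈ ({u, v} : Finset X) := by rw [h]
  simpa [mem_rowNbrs, hx] using this

theorem IsSurplusLeafless.two_mul_card_le_total (h : IsSurplusLeafless w A B) :
    2 * B.card ≤ total w A B := by
  rw [mul_comm, ← smul_eq_mul]
  exact Finset.card_nsmul_le_sum _ _ _ fun y hy =>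
    (h.leafless y hy).trans (card_rowNbrs_le_sum w A y)

theorem sum_eq_card_rowNbrs {y : Y} (hs : ∀ x ∈ A, w x y ≠ 0 → w x y = 1) :
    ∑ x ∈ A, w x y = (rowNbrs w A y).card := by
  rw [rowNbrs, Finset.card_filter]
  refine Finset.sum_congr rfl fun x hx => ?_
  by_cases hw : w x y = 0
  · simp [hw]
  · simp [hs x hx hw]

theorem total_sdiff {K : Finset Y} (hK : K ⊆ B) (h : ∀ y ∈ K, ∑ x ∈ A, w x y = 2) :
    total w A B = total w A (B \ K) + 2 * K.card := by
  rw [total, ← Finset.sum_sdiff hK, Finset.sum_congr rfl h]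
  simp [total, mul_comm]

theorem total_eq_erase_erase (w : X → Y → ℕ) {A : Finset X} (B : Finset Y) (hu : u ∈ A)
    (hv : v ∈ A) (hne : u ≠ v) :
    total w A B =
      ∑ y ∈ B, w u y + ∑ y ∈ B, w v y + total w ((A.erase u).erase v) B := by
  rw [total, total, ← Finset.sum_add_distrib, ← Finset.sum_add_distrib]
  refine Finset.sum_congr rfl fun y _ => ?_
  rw [← Finset.add_sum_erase A _ hu,
    ← Finset.add_sum_erase (A.erase u) _ (Finset.mem_erase.2 ⟨hne.symm, hv⟩), add_assoc]

theorem matchCount_lowerEntry {x : X} {y : Y} (hx : x ∈ A) (hy : y ∈ B) (hw : w x y ≠ 0) :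
    matchCount w A B =
      matchCount (lowerEntry w x y) A B + matchCount w (A.erase x) (B.erase y) := by
  have hc : ∀ z, matchCount (lowerEntry w x y) (A.erase x) (B.erase z) =
      matchCount w (A.erase x) (B.erase z) := fun z =>
    matchCount_congr fun x' hx' v _ => lowerEntry_of_ne w fun hh => (Finset.mem_erase.1 hx').1 hh.1
  rw [matchCount_row w hx, matchCount_row (lowerEntry w x y) hx, ← Finset.add_sum_erase B _ hy,
    ← Finset.add_sum_erase B (fun z => lowerEntry w x y x z * _) hy, lowerEntry_self]
  have hs : ∑ z ∈ B.erase y, lowerEntry w x y x z *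
      matchCount (lowerEntry w x y) (A.erase x) (B.erase z) =
      ∑ z ∈ B.erase y, w x z * matchCount w (A.erase x) (B.erase z) := by
    refine Finset.sum_congr rfl fun z hz => ?_
    rw [hc, lowerEntry_of_ne w fun hh => (Finset.mem_erase.1 hz).1 hh.2]
  rw [hs, hc]
  obtain ⟨a, ha⟩ := Nat.exists_eq_succ_of_ne_zero hw
  rw [ha]
  simp only [Nat.succ_eq_add_one, Nat.add_sub_cancel]
  ring

theorem total_lowerEntry {x : X} {y : Y} (hx : x ∈ A) (hy : y ∈ B) (hw : w x y ≠ 0) :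
    total w A B = total (lowerEntry w x y) A B + 1 := by
  rw [total, total, ← Finset.add_sum_erase B _ hy,
    ← Finset.add_sum_erase B (fun v => ∑ z ∈ A, lowerEntry w x y z v) hy,
    ← Finset.add_sum_erase A _ hx, ← Finset.add_sum_erase A (fun z => lowerEntry w x y z y) hx,
    lowerEntry_self]
  have h1 : ∑ z ∈ A.erase x, lowerEntry w x y z y = ∑ z ∈ A.erase x, w z y :=
    Finset.sum_congr rfl fun z hz => lowerEntry_of_ne w fun hh => (Finset.mem_erase.1 hz).1 hh.1
  have h2 : ∑ v ∈ B.erase y, ∑ z ∈ A, lowerEntry w x y z v = ∑ v ∈ B.erase y, ∑ z ∈ A, w z v :=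
    Finset.sum_congr rfl fun v hv => Finset.sum_congr rfl fun z _ =>
      lowerEntry_of_ne w fun hh => (Finset.mem_erase.1 hv).1 hh.2
  rw [h1, h2]
  omega

theorem boundHolds_of_lowerEntry (h : IsSurplusLeafless w A B) {x : X} {y : Y} (hx : x ∈ A)
    (hy : y ∈ B) (hw : w x y ≠ 0) (hl : IsSurplusLeafless (lowerEntry w x y) A B)
    (hb : BoundHolds (lowerEntry w x y) A B) : BoundHolds w A B := by
  intro m t b hA hB ht
  have h1 := total_lowerEntry hx hy hw
  have h2 := hl.two_mul_card_le_total
  obtain ⟨b, rfl⟩ : ∃ b', b = b' + 1 := ⟨b - 1, by omega⟩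
  have h3 := hb m t b hA hB (by omega)
  -- These are the matchings through the removed edge. Proper row sets have surplus, so Hall's
  -- condition survives the loss of `y`.
  have h4 : t + 1 ≤ matchCount w (A.erase x) (B.erase y) := by
    refine excess_add_one_le_matchCount (matchCount_pos_of_hall w fun S hS => ?_) ?_ ?_
    · rcases S.eq_empty_or_nonempty with rfl | hne
      · simp
      · have h5 := h.surplus S (hS.trans (Finset.erase_subset _ _)) hne
          (fun he => Finset.notMem_erase x A (hS (he ▸ hx)))
        have h6 := card_colNbrs_erase w B S y
        omega
    · rw [Finset.card_erase_of_mem hx, Finset.card_erase_of_mem hy]; omega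
    · intro z hz
      exact exists_ne_of_two_le_card_rowNbrs (h.leafless z (Finset.mem_of_mem_erase hz)) x
  rw [matchCount_lowerEntry hx hy hw]
  calc ((m + 1) * t + 2 + (b + 1)) * (t + 1)
      = ((m + 1) * t + 2 + b) * (t + 1) + (t + 1) := by ring
    _ ≤ _ := Nat.add_le_add h3 h4

theorem boundHolds_of_card_eq_two (h : IsSurplusLeafless w A B)
    (hs : ∀ x ∈ A, ∀ y ∈ B, w x y ≠ 0 → w x y = 1) (hA2 : A.card = 2) : BoundHolds w A B := by
  intro m t b hA hB ht
  obtain rfl : m = 0 := by omega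
  -- A simple graph with two rows has column degrees at most two, so there are no surplus edges: b =
  -- 0.
  have h1 : total w A B ≤ B.card • 2 := Finset.sum_le_card_nsmul _ _ _ fun y hy => by
    rw [sum_eq_card_rowNbrs fun x hx => hs x hx y hy, ← hA2]
    exact Finset.card_le_card (Finset.filter_subset _ _)
  rw [smul_eq_mul] at h1
  obtain rfl : b = 0 := by omega
  have h2 := quadratic_le_matchCount (matchCount_pos_of_hall w fun S hS => h.hall hS)
    (Finset.card_pos.1 (by omega)) (by omega : B.card = A.card + t) h.leafless
  calc ((0 + 1) * t + 2 + 0) * (t + 1) = (t + 1) * (t + 2) := by ring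
    _ ≤ _ := h2

theorem matchCount_col_single (w : X → Y → ℕ) {A : Finset X} {B : Finset Y} {x : X} {y : Y}
    (hx : x ∈ A) (hy : y ∈ B) (h1 : w x y = 1) (h0 : ∀ z ∈ A, z ≠ x → w z y = 0) :
    matchCount w A B = matchCount w A (B.erase y) + matchCount w (A.erase x) (B.erase y) := by
  rw [matchCount_col w A hy, Finset.sum_eq_single_of_mem x hx, h1, one_mul]
  intro z hz hzx
  rw [h0 z hz hzx, zero_mul]

theorem matchCount_col_pair (w : X → Y → ℕ) {A : Finset X} {B : Finset Y} {y : Y}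
    (hu : u ∈ A) (hv : v ∈ A) (hne : u ≠ v) (hy : y ∈ B) (h1 : w u y = 1) (h2 : w v y = 1)
    (h0 : ∀ z ∈ A, z ≠ u → z ≠ v → w z y = 0) :
    matchCount w A B = matchCount w A (B.erase y) +
      (matchCount w (A.erase u) (B.erase y) + matchCount w (A.erase v) (B.erase y)) := by
  have hsub : ({u, v} : Finset X) ⊆ A :=
    Finset.insert_subset hu (Finset.singleton_subset_iff.2 hv)
  rw [matchCount_col w A hy, ← Finset.sum_subset hsub, Finset.sum_pair hne, h1, h2, one_mul,
    one_mul]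
  intro z hz hz'
  simp only [Finset.mem_insert, Finset.mem_singleton, not_or] at hz'
  rw [h0 z hz hz'.1 hz'.2, zero_mul]

/-- Columns of `K` serve neither of `u`, `v`, exactly one of them, or both, the last in k(k - 1)
ways. -/
theorem matchCount_eq_of_twins (w : X → Y → ℕ) {A : Finset X} {B K : Finset Y} (hK : K ⊆ B)
    (hu : u ∈ A) (hv : v ∈ A) (hne : u ≠ v) (h1 : ∀ y ∈ K, w u y = 1) (h2 : ∀ y ∈ K, w v y = 1)
    (h0 : ∀ y ∈ K, ∀ z ∈ A, z ≠ u → z ≠ v → w z y = 0) :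
    matchCount w A B = matchCount w A (B \ K) +
      K.card * (matchCount w (A.erase u) (B \ K) + matchCount w (A.erase v) (B \ K)) +
      K.card * (K.card - 1) * matchCount w ((A.erase u).erase v) (B \ K) := by
  induction K using Finset.induction_on with
  | empty => simp
  | insert y K hyK ih =>
    have hyB : y ∈ B \ K := Finset.mem_sdiff.2 ⟨hK (Finset.mem_insert_self _ _), hyK⟩
    have e1 := h1 y (Finset.mem_insert_self _ _)
    have e2 := h2 y (Finset.mem_insert_self _ _)
    have e0 := h0 y (Finset.mem_insert_self _ _)
    have hsd : B \ insert y K = (B \ K).erase y := by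
      ext z; simp only [Finset.mem_sdiff, Finset.mem_insert, Finset.mem_erase]; tauto
    rw [ih ((Finset.subset_insert _ _).trans hK) (fun z hz => h1 z (Finset.mem_insert_of_mem hz))
      (fun z hz => h2 z (Finset.mem_insert_of_mem hz))
      (fun z hz => h0 z (Finset.mem_insert_of_mem hz)), hsd, Finset.card_insert_of_notMem hyK,
      matchCount_col_pair w hu hv hne hyB e1 e2 e0,
      matchCount_col_single w (x := v) (Finset.mem_erase.2 ⟨hne.symm, hv⟩) hyB e2
        (fun z hz hzv => e0 z (Finset.mem_of_mem_erase hz) (Finset.mem_erase.1 hz).1 hzv),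
      matchCount_col_single w (A := A.erase v) (x := u) (Finset.mem_erase.2 ⟨hne, hu⟩) hyB e1
        (fun z hz hzu => e0 z (Finset.mem_of_mem_erase hz) hzu (Finset.mem_erase.1 hz).1),
      Finset.erase_right_comm (a := v),
      ← matchCount_erase_of_col_zero w ((A.erase u).erase v) (B \ K) (y := y)
        (fun z hz => by
          simp only [Finset.mem_erase] at hz
          exact e0 z hz.2.2 hz.2.1 hz.1)]
    rcases K.card with _ | k
    · simp
    · simp only [Nat.add_sub_cancel]; ring

theorem exists_third (h : IsSurplusLeafless w A B) {y : Y} (hy : y ∈ B \ twins w A B u v) :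
    ∃ z ∈ A, z ≠ u ∧ z ≠ v ∧ w z y ≠ 0 := by
  obtain ⟨hyB, hyK⟩ := Finset.mem_sdiff.1 hy
  by_contra hno
  push Not at hno
  refine hyK (mem_twins.2 ⟨hyB, Finset.eq_of_subset_of_card_le (fun z hz => ?_) ?_⟩)
  · obtain ⟨hzA, hwz⟩ := mem_rowNbrs.1 hz
    by_contra hz'
    simp only [Finset.mem_insert, Finset.mem_singleton, not_or] at hz'
    exact hwz (hno z hzA hz'.1 hz'.2)
  · exact Finset.card_le_two.trans (h.leafless y hyB)

theorem colNbrs_sdiff_twins {S : Finset X} (hS : S ⊆ (A.erase u).erase v) :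
    colNbrs w (B \ twins w A B u v) S = colNbrs w B S := by
  ext y
  simp only [mem_colNbrs, Finset.mem_sdiff]
  constructor
  · rintro ⟨⟨hB, _⟩, hx⟩; exact ⟨hB, hx⟩
  · rintro ⟨hB, x, hx, hw⟩
    refine ⟨⟨hB, fun hy => ?_⟩, x, hx, hw⟩
    have hx' := hS hx
    simp only [Finset.mem_erase] at hx'
    rcases (ne_zero_iff_of_mem_twins hy hx'.2.2).1 hw with rfl | rfl
    · exact hx'.2.1 rfl
    · exact hx'.1 rfl

/-- Restriction to fewer rows and columns that does not cut off any neighbours. -/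
theorem IsSurplusLeafless.restrict (h : IsSurplusLeafless w A B) {R : Finset X} {D : Finset Y}
    (hR : R ⊆ A) (hRA : R ≠ A) (hne : R.Nonempty)
    (hcol : ∀ S ⊆ R, colNbrs w D S = colNbrs w B S)
    (hleaf : ∀ y ∈ D, 2 ≤ (rowNbrs w R y).card) :
    IsSurplusLeafless w R D ∧ R.card < D.card := by
  have hlt : R.card < D.card := by
    have h1 := h.surplus R hR hne hRA
    rw [← hcol R subset_rfl] at h1
    exact h1.trans_le (Finset.card_le_card (colNbrs_subset _ _ _))
  refine ⟨⟨?_, hlt.le, fun S hS hSne _ => ?_, hleaf⟩, hlt⟩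
  · obtain ⟨y, hy⟩ := Finset.card_pos.1 (lt_of_le_of_lt (Nat.zero_le _) hlt)
    exact (hleaf y hy).trans (Finset.card_le_card (Finset.filter_subset _ _))
  · rw [hcol S hS]
    exact h.surplus S (hS.trans hR) hSne
      (fun he => hRA (Finset.Subset.antisymm hR (he ▸ hS)))

theorem card_erase_erase (hu : u ∈ A) (hv : v ∈ A) (hne : u ≠ v) :
    ((A.erase u).erase v).card + 2 = A.card := by
  have h1 := Finset.card_erase_add_one (Finset.mem_erase.2 ⟨hne.symm, hv⟩ : v ∈ A.erase u)
  have h2 := Finset.card_erase_add_one hu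
  omega

theorem erase_erase_ne (hu : u ∈ A) : (A.erase u).erase v ≠ A := by
  intro he
  rw [← he] at hu
  simp at hu

theorem card_lt_card_sdiff_twins (h : IsSurplusLeafless w A B) (hu : u ∈ A)
    (hv : v ∈ A) (hne : u ≠ v) (hA : 3 ≤ A.card) :
    A.card < (B \ twins w A B u v).card + 2 := by
  have hc := card_erase_erase hu hv hne
  have h1 := h.surplus ((A.erase u).erase v)
    ((Finset.erase_subset _ _).trans (Finset.erase_subset _ _))
    (Finset.card_pos.1 (by omega)) (erase_erase_ne hu)
  rw [← colNbrs_sdiff_twins subset_rfl] at h1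
  have h2 := Finset.card_le_card (colNbrs_subset w (B \ twins w A B u v) ((A.erase u).erase v))
  omega

theorem card_sdiff_twins_add (w : X → Y → ℕ) (A : Finset X) (B : Finset Y) (u v : X) :
    (B \ twins w A B u v).card + (twins w A B u v).card = B.card :=
  Finset.card_sdiff_add_card_eq_card (twins_subset w A B u v)

theorem sum_col_twins (hs : ∀ x ∈ A, ∀ y ∈ B, w x y ≠ 0 → w x y = 1) (hne : u ≠ v) {y : Y}
    (hy : y ∈ twins w A B u v) : ∑ x ∈ A, w x y = 2 := by
  obtain ⟨hyB, hrow⟩ := mem_twins.1 hy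
  rw [sum_eq_card_rowNbrs fun x hx => hs x hx y hyB, hrow, Finset.card_pair hne]

theorem matchCount_twins (hs : ∀ x ∈ A, ∀ y ∈ B, w x y ≠ 0 → w x y = 1)
    (hu : u ∈ A) (hv : v ∈ A) (hne : u ≠ v) {K D : Finset Y} (hK : K = twins w A B u v)
    (hD : D = B \ K) :
    matchCount w A B = matchCount w A D +
      K.card * (matchCount w (A.erase u) D + matchCount w (A.erase v) D) +
      K.card * (K.card - 1) * matchCount w ((A.erase u).erase v) D := by
  subst hK hD
  have hsub := twins_subset w A B u v
  refine matchCount_eq_of_twins w hsub hu hv hne (fun y hy => ?_) (fun y hy => ?_)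
    fun y hy z hz hzu hzv => ?_
  · exact hs u hu y (hsub hy) ((ne_zero_iff_of_mem_twins hy hu).2 (Or.inl rfl))
  · exact hs v hv y (hsub hy) ((ne_zero_iff_of_mem_twins hy hv).2 (Or.inr rfl))
  · by_contra hw
    rcases (ne_zero_iff_of_mem_twins hy hz).1 hw with h | h
    · exact hzu h
    · exact hzv h

theorem mergeRows_ne_zero_of_ne {x : X} {y : Y} (hx : x ≠ v) :
    mergeRows w u v x y ≠ 0 ↔ w x y ≠ 0 := by
  rw [mergeRows, Function.update_of_ne hx]

theorem mergeRows_self_ne_zero {y : Y} :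
    mergeRows w u v v y ≠ 0 ↔ w u y ≠ 0 ∨ w v y ≠ 0 := by
  simp only [mergeRows, Function.update_self]
  omega

/-- A set containing the merged row comes from one containing both `u` and `v`, with one row and the
columns `K` removed; `hm` is the surplus needed. Columns outside `K` have a neighbour other than
`u`, `v`, so they keep two neighbours. -/
theorem isSurplusLeafless_mergeRows (h : IsSurplusLeafless w A B) (hu : u ∈ A) (hv : v ∈ A)
    (hne : u ≠ v) (hA : 3 ≤ A.card) {K D : Finset Y} (hK : K = twins w A B u v)
    (hD : D = B \ K)
    (hm : ∀ S ⊆ A, u ∈ S → v ∈ S → S ≠ A → S.card + K.card ≤ (colNbrs w B S).card) :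
    IsSurplusLeafless (mergeRows w u v) (A.erase u) D := by
  have hvu : v ∈ A.erase u := Finset.mem_erase.2 ⟨hne.symm, hv⟩
  have hcA := Finset.card_erase_add_one hu
  refine ⟨by omega, ?_, fun S hS hSne hSA => ?_, fun y hy => ?_⟩
  · have := card_lt_card_sdiff_twins h hu hv hne hA
    rw [← hK, ← hD] at this
    omega
  · by_cases hvS : v ∈ S
    · have huS : u ∉ S := fun hmem => Finset.notMem_erase u A (hS hmem)
      have h1 := hm (insert u S) (Finset.insert_subset hu (hS.trans (Finset.erase_subset _ _)))
        (Finset.mem_insert_self _ _) (Finset.mem_insert_of_mem hvS)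
        (fun he => hSA (by rw [← he, Finset.erase_insert huS]))
      rw [Finset.card_insert_of_notMem huS] at h1
      have hsub : colNbrs w B (insert u S) ⊆ colNbrs (mergeRows w u v) D S ∪ K := by
        intro y hy
        obtain ⟨hyB, x, hx, hw⟩ := mem_colNbrs.1 hy
        by_cases hyK : y ∈ K
        · exact Finset.mem_union_right _ hyK
        refine Finset.mem_union_left _ (mem_colNbrs.2 ⟨hD ▸ Finset.mem_sdiff.2 ⟨hyB, hyK⟩, ?_⟩)
        by_cases hxv : x = v
        · exact ⟨v, hvS, mergeRows_self_ne_zero.2 (Or.inr (hxv ▸ hw))⟩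
        rcases Finset.mem_insert.1 hx with hxu | hxS
        · exact ⟨v, hvS, mergeRows_self_ne_zero.2 (Or.inl (hxu ▸ hw))⟩
        · exact ⟨x, hxS, (mergeRows_ne_zero_of_ne hxv).2 hw⟩
      have h2 := Finset.card_le_card hsub
      have h3 := Finset.card_union_le (colNbrs (mergeRows w u v) D S) K
      omega
    · have hS' : S ⊆ (A.erase u).erase v := Finset.subset_erase.2 ⟨hS, hvS⟩
      rw [colNbrs_congr (w' := w) fun x hx y _ =>
        mergeRows_ne_zero_of_ne (v := v) (fun he => hvS (he ▸ hx)), hD, hK, colNbrs_sdiff_twins hS']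
      refine h.surplus S (hS.trans (Finset.erase_subset _ _)) hSne fun he => ?_
      exact Finset.notMem_erase u A (hS (he ▸ hu))
  · rw [hD, hK] at hy
    obtain ⟨z, hzA, hzu, hzv, hwz⟩ := exists_third h hy
    have hz : z ∈ rowNbrs (mergeRows w u v) (A.erase u) y :=
      mem_rowNbrs.2 ⟨Finset.mem_erase.2 ⟨hzu, hzA⟩, (mergeRows_ne_zero_of_ne hzv).2 hwz⟩
    obtain ⟨x, hx, hwx⟩ := exists_ne_of_two_le_card_rowNbrs
      (h.leafless y (Finset.mem_sdiff.1 hy).1) z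
    obtain ⟨hxz, hxA⟩ := Finset.mem_erase.1 hx
    by_cases hxuv : x = u ∨ x = v
    · have hv' : v ∈ rowNbrs (mergeRows w u v) (A.erase u) y := by
        refine mem_rowNbrs.2 ⟨hvu, mergeRows_self_ne_zero.2 ?_⟩
        rcases hxuv with rfl | rfl
        · exact Or.inl hwx
        · exact Or.inr hwx
      exact Finset.one_lt_card.2 ⟨z, hz, v, hv', hzv⟩
    · push Not at hxuv
      have hx' : x ∈ rowNbrs (mergeRows w u v) (A.erase u) y :=
        mem_rowNbrs.2 ⟨Finset.mem_erase.2 ⟨hxuv.1, hxA⟩, (mergeRows_ne_zero_of_ne hxuv.2).2 hwx⟩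
      exact Finset.one_lt_card.2 ⟨z, hz, x, hx', hxz.symm⟩

theorem total_mergeRows (w : X → Y → ℕ) {A : Finset X} (D : Finset Y) (hu : u ∈ A) (hv : v ∈ A)
    (hne : u ≠ v) : total (mergeRows w u v) (A.erase u) D = total w A D :=
  Finset.sum_congr rfl fun y _ => sum_mergeRows w hu hv hne y

/-- Here j + 2 is the size of the twin class and q is the excess of the merged matrix. -/
theorem merge_arith (m q b j : ℕ) :
    ((m + 1 + 1) * (q + j + 1) + 2 + b) * (q + j + 1 + 1) ≤
      (j + 2) * (((m + 1) * q + 2 + b) * (q + 1)) + (j + 2) * (j + 1) * (m + 2 + q) := by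
  rcases q with _ | q
  · ring_nf; omega
  · ring_nf; omega

theorem boundHolds_of_mergeRows (h : IsSurplusLeafless w A B)
    (hs : ∀ x ∈ A, ∀ y ∈ B, w x y ≠ 0 → w x y = 1) (hu : u ∈ A) (hv : v ∈ A)
    (hne : u ≠ v) (hA3 : 3 ≤ A.card) {K D : Finset Y} (hK : K = twins w A B u v)
    (hD : D = B \ K) (hKne : K.Nonempty)
    (hb : BoundHolds (mergeRows w u v) (A.erase u) D) : BoundHolds w A B := by
  intro m t b hA hB ht
  obtain ⟨m, rfl⟩ : ∃ m', m = m' + 1 := ⟨m - 1, by omega⟩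
  have hKc := Finset.card_pos.2 hKne
  have hDc := card_lt_card_sdiff_twins h hu hv hne hA3
  have hDK := card_sdiff_twins_add w A B u v
  have htot := total_sdiff (w := w) (twins_subset w A B u v) (fun y hy => sum_col_twins hs hne hy)
  rw [← hK, ← hD] at hDc hDK htot
  have hcA := Finset.card_erase_add_one hu
  obtain ⟨q, hq⟩ : ∃ q, D.card = m + 2 + q := ⟨D.card - (m + 2), by omega⟩
  have h1 := hb m q b (by omega) hq (by rw [total_mergeRows w D hu hv hne]; omega)
  rw [matchCount_mergeRows w D hu hv hne] at h1
  rw [matchCount_twins hs hu hv hne hK hD]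
  by_cases hk1 : K.card = 1
  · obtain rfl : q = t := by omega
    -- With one twin the excess is unchanged by merging, and the target grows by exactly t(t + 1),
    -- supplied by the matchings avoiding the twin column.
    have h0 : q * (q + 1) ≤ matchCount w A D := by
      rcases q with _ | q
      · simp
      · obtain ⟨y, hy⟩ := Finset.card_eq_one.1 hk1
        have hDe : D = B.erase y := by rw [hD, hy, Finset.sdiff_singleton_eq_erase]
        refine quadratic_le_matchCount (matchCount_pos_of_hall w fun S hS => ?_) ⟨u, hu⟩
          (by omega) fun z hz => h.leafless z ?_
        · rcases S.eq_empty_or_nonempty with rfl | hSne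
          · simp
          · have h5 := h.surplus_of_lt (by omega) hS hSne
            have h6 := card_colNbrs_erase w B S y
            rw [hDe]
            omega
        · rw [hDe] at hz
          exact Finset.mem_of_mem_erase hz
    rw [hk1]
    calc ((m + 1 + 1) * q + 2 + b) * (q + 1)
        = q * (q + 1) + ((m + 1) * q + 2 + b) * (q + 1) := by ring
      _ ≤ _ := by simp only [one_mul, Nat.sub_self, zero_mul, add_zero]; omega
  · obtain ⟨j, hj⟩ : ∃ j, K.card = j + 2 := ⟨K.card - 2, by omega⟩
    obtain rfl : t = q + j + 1 := by omega
    have hc := card_erase_erase hu hv hne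
    -- With at least two twins, P(A, D) is dropped and the term with both `u` and `v` matched into
    -- `K` makes up the difference.
    have h2 : m + 2 + q ≤ matchCount w ((A.erase u).erase v) D := by
      rw [← hq]
      refine card_le_matchCount (Finset.card_pos.1 (by omega)) (fun S hS hSne => ?_) fun y hy => ?_
      · rw [hD, hK, colNbrs_sdiff_twins hS]
        refine h.surplus S (hS.trans ((Finset.erase_subset _ _).trans (Finset.erase_subset _ _)))
          hSne fun he => ?_
        have := hS (he ▸ hu)
        simp at this
      · rw [hD, hK] at hy
        obtain ⟨z, hzA, hzu, hzv, hwz⟩ := exists_third h hy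
        exact ⟨z, by simp [hzA, hzu, hzv], hwz⟩
    rw [hj]
    have h3 := Nat.mul_le_mul_left (j + 2) h1
    have h4 := Nat.mul_le_mul_left ((j + 2) * (j + 1)) h2
    have h5 := merge_arith m q b j
    have h6 : j + 2 - 1 = j + 1 := rfl
    rw [h6]
    omega

end LowerBound

/-! ### The three configurations in which merging can fail -/

section SmallBoundary

variable {X Y : Type*} [DecidableEq X] [DecidableEq Y]
variable {w : X → Y → ℕ} {A : Finset X} {B : Finset Y} {u v : X}

/-- In this and the next two inequalities, m + 2 rows of excess q + 1 remain after the configuration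
is removed; the twin class has j + 3 columns here and j + 2 below. -/
theorem isolated_arith (m q b j : ℕ) :
    ((m + 1 + 1 + 1) * (q + j + 2) + 2 + b) * (q + j + 2 + 1) ≤
      (j + 3) * (j + 2) * (((m + 1) * (q + 1) + 2 + b) * (q + 2)) := by
  ring_nf; omega

theorem bridge_arith (m q b j : ℕ) :
    ((m + 1 + 1 + 1) * (q + j + 1) + 2 + (b + 1)) * (q + j + 1 + 1) ≤
      (j + 2) * ((q + 1) * (q + 2)) +
        (j + 2) * (j + 1) * (((m + 1) * (q + 1) + 2 + b) * (q + 2)) := by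
  ring_nf; omega

theorem path_arith (m q b j : ℕ) :
    ((m + 3 + 1) * (q + 1 + j + 1) + 2 + b) * (q + 1 + j + 1 + 1) ≤
      2 * (j + 2) ^ 2 * (((m + 1) * (q + 1) + 2 + b) * (q + 1 + 1)) := by
  ring_nf; omega

theorem rowNbrs_erase_of_eq_zero {x : X} {y : Y} (h : w x y = 0) :
    rowNbrs w (A.erase x) y = rowNbrs w A y := by
  ext z
  simp only [mem_rowNbrs, Finset.mem_erase]
  constructor
  · rintro ⟨⟨_, hz⟩, hw⟩; exact ⟨hz, hw⟩
  · rintro ⟨hz, hw⟩; exact ⟨⟨fun he => hw (he ▸ h), hz⟩, hw⟩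

theorem card_rowNbrs_erase (w : X → Y → ℕ) (A : Finset X) (x : X) (y : Y) :
    (rowNbrs w A y).card ≤ (rowNbrs w (A.erase x) y).card + 1 := by
  have h1 : (rowNbrs w A y).erase x ⊆ rowNbrs w (A.erase x) y := by
    intro z hz
    simp only [mem_rowNbrs, Finset.mem_erase] at hz ⊢
    tauto
  have h2 := Finset.card_le_card h1
  have h3 := Finset.pred_card_le_card_erase (s := rowNbrs w A y) (a := x)
  omega

/-- The rows `u` and `v` and the columns adjacent to both form a component. -/
theorem boundHolds_of_isolated (h : IsSurplusLeafless w A B)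
    (hs : ∀ x ∈ A, ∀ y ∈ B, w x y ≠ 0 → w x y = 1) (hu : u ∈ A) (hv : v ∈ A)
    (hne : u ≠ v) (hA3 : 3 ≤ A.card) {K D : Finset Y} (hK : K = twins w A B u v)
    (hD : D = B \ K) (hzu : ∀ y ∈ D, w u y = 0) (hzv : ∀ y ∈ D, w v y = 0)
    (ih : IsSurplusLeafless w ((A.erase u).erase v) D →
      total w ((A.erase u).erase v) D < total w A B → BoundHolds w ((A.erase u).erase v) D) :
    BoundHolds w A B := by
  intro m t b hA hB ht
  have hDK := card_sdiff_twins_add w A B u v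
  have htot := total_sdiff (w := w) (twins_subset w A B u v) (fun y hy => sum_col_twins hs hne hy)
  rw [← hK, ← hD] at hDK htot
  have hc := card_erase_erase hu hv hne
  obtain ⟨hgood, hlt⟩ := h.restrict (R := (A.erase u).erase v) (D := D)
    ((Finset.erase_subset _ _).trans (Finset.erase_subset _ _)) (erase_erase_ne hu)
    (Finset.card_pos.1 (by omega)) (fun S hS => by rw [hD, hK, colNbrs_sdiff_twins hS])
    (fun y hy => by
      rw [rowNbrs_erase_of_eq_zero (hzv y hy), rowNbrs_erase_of_eq_zero (hzu y hy)]
      exact h.leafless y (Finset.mem_sdiff.1 (hD ▸ hy)).1)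
  -- All neighbours of {u, v} lie in `K`, so surplus of this pair gives three columns.
  have hk3 : 3 ≤ K.card := by
    have h1 := h.surplus {u, v} (Finset.insert_subset hu (Finset.singleton_subset_iff.2 hv))
      ⟨u, by simp⟩ (fun he => by
        have := congrArg Finset.card he
        rw [Finset.card_pair hne] at this
        omega)
    rw [Finset.card_pair hne] at h1
    refine h1.trans_le (Finset.card_le_card fun y hy => ?_)
    obtain ⟨hyB, x, hx, hw⟩ := mem_colNbrs.1 hy
    by_contra hyK
    have hyD : y ∈ D := hD ▸ Finset.mem_sdiff.2 ⟨hyB, hyK⟩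
    simp only [Finset.mem_insert, Finset.mem_singleton] at hx
    rcases hx with rfl | rfl
    · exact hw (hzu y hyD)
    · exact hw (hzv y hyD)
  have htot2 := total_eq_erase_erase w D hu hv hne
  rw [Finset.sum_eq_zero hzu, Finset.sum_eq_zero hzv] at htot2
  have h2 := hgood.two_le
  obtain ⟨m, rfl⟩ : ∃ m', m = m' + 2 := ⟨m - 2, by omega⟩
  obtain ⟨q, hq⟩ : ∃ q, D.card = m + 2 + (q + 1) := ⟨D.card - (m + 3), by omega⟩
  obtain ⟨j, hj⟩ : ∃ j, K.card = j + 3 := ⟨K.card - 3, by omega⟩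
  obtain rfl : t = q + j + 2 := by omega
  have h3 := ih hgood (by omega) m (q + 1) b (by omega) hq (by omega)
  rw [matchCount_twins hs hu hv hne hK hD, hj]
  have h4 := Nat.mul_le_mul_left ((j + 3) * (j + 2)) h3
  have h5 := isolated_arith m q b j
  have h6 : j + 3 - 1 = j + 2 := rfl
  rw [h6]
  have h7 : q + 1 + 1 = q + 2 := rfl
  rw [h7] at h4
  have h8 : m + 2 + 1 = m + 1 + 1 + 1 := rfl
  rw [h8]
  omega

/-- Apart from the columns adjacent to both `u` and `v`, only one column `y₀` meets `u`
and none meets `v`. -/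
theorem boundHolds_of_bridge (h : IsSurplusLeafless w A B)
    (hs : ∀ x ∈ A, ∀ y ∈ B, w x y ≠ 0 → w x y = 1) (hu : u ∈ A) (hv : v ∈ A)
    (hne : u ≠ v) (hA3 : 3 ≤ A.card) {K D : Finset Y} (hK : K = twins w A B u v)
    (hD : D = B \ K) (hK2 : 2 ≤ K.card) {y₀ : Y} (hy₀ : y₀ ∈ D) (hwu : w u y₀ ≠ 0)
    (hdeg : 3 ≤ (rowNbrs w A y₀).card)
    (hzu : ∀ y ∈ D, y ≠ y₀ → w u y = 0) (hzv : ∀ y ∈ D, w v y = 0)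
    (ih : IsSurplusLeafless w ((A.erase u).erase v) D →
      total w ((A.erase u).erase v) D < total w A B → BoundHolds w ((A.erase u).erase v) D) :
    BoundHolds w A B := by
  intro m t b hA hB ht
  have hDB : D ⊆ B := hD ▸ Finset.sdiff_subset
  have hDK := card_sdiff_twins_add w A B u v
  have htot := total_sdiff (w := w) (twins_subset w A B u v) (fun y hy => sum_col_twins hs hne hy)
  rw [← hK, ← hD] at hDK htot
  have hc := card_erase_erase hu hv hne
  have hleaf : ∀ y ∈ D, 2 ≤ (rowNbrs w ((A.erase u).erase v) y).card := by
    intro y hy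
    rw [rowNbrs_erase_of_eq_zero (hzv y hy)]
    by_cases hyy : y = y₀
    · subst hyy
      have := card_rowNbrs_erase w A u y
      omega
    · rw [rowNbrs_erase_of_eq_zero (hzu y hy hyy)]
      exact h.leafless y (hDB hy)
  have hsubA : (A.erase u).erase v ⊆ A := (Finset.erase_subset _ _).trans (Finset.erase_subset _ _)
  obtain ⟨hgood, hlt⟩ := h.restrict (R := (A.erase u).erase v) (D := D)
    hsubA (erase_erase_ne hu)
    (Finset.card_pos.1 (by omega)) (fun S hS => by rw [hD, hK, colNbrs_sdiff_twins hS]) hleaf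
  have htot2 := total_eq_erase_erase w D hu hv hne
  rw [Finset.sum_eq_zero hzv, Finset.sum_eq_single_of_mem y₀ hy₀ hzu,
    hs u hu y₀ (hDB hy₀) hwu] at htot2
  have h2 := hgood.two_le
  have hge := hgood.two_mul_card_le_total
  obtain ⟨m, rfl⟩ : ∃ m', m = m' + 2 := ⟨m - 2, by omega⟩
  obtain ⟨q, hq⟩ : ∃ q, D.card = m + 2 + (q + 1) := ⟨D.card - (m + 3), by omega⟩
  obtain ⟨j, hj⟩ : ∃ j, K.card = j + 2 := ⟨K.card - 2, by omega⟩
  obtain ⟨b, rfl⟩ : ∃ b', b = b' + 1 := ⟨b - 1, by omega⟩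
  obtain rfl : t = q + j + 1 := by omega
  have h3 := ih hgood (by omega) m (q + 1) b (by omega) hq (by omega)
  have hcD := Finset.card_erase_add_one hy₀
  -- Match `u` to `y₀`; the remaining rows still have excess q and column degrees at least two.
  have h4 : (q + 1) * (q + 2) ≤ matchCount w (A.erase v) D := by
    rw [matchCount_row w (Finset.mem_erase.2 ⟨hne, hu⟩ : u ∈ A.erase v)]
    refine le_trans ?_ (Finset.single_le_sum
      (f := fun y => w u y * matchCount w ((A.erase v).erase u) (D.erase y))
      (fun _ _ => Nat.zero_le _) hy₀)
    refine le_trans ?_ (Nat.le_mul_of_pos_left _ (Nat.pos_of_ne_zero hwu))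
    rw [Finset.erase_right_comm]
    refine quadratic_le_matchCount (matchCount_pos_of_hall w fun S hS => ?_)
      (Finset.card_pos.1 (by omega)) (by omega) fun y hy => hleaf y (Finset.mem_of_mem_erase hy)
    rcases S.eq_empty_or_nonempty with rfl | hSne
    · simp
    · have h5 := hgood.surplus_of_lt hlt hS hSne
      have h6 := card_colNbrs_erase w D S y₀
      omega
  rw [matchCount_twins hs hu hv hne hK hD, hj]
  have h5 := Nat.mul_le_mul_left ((j + 2) * (j + 1)) h3
  have h6 := Nat.mul_le_mul_left (j + 2) h4
  have h7 := bridge_arith m q b j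
  have h8 : j + 2 - 1 = j + 1 := rfl
  rw [h8, mul_add (j + 2) (matchCount w (A.erase u) D)]
  have h9 : q + 1 + 1 = q + 2 := rfl
  rw [h9] at h5
  have h10 : m + 2 + 1 = m + 1 + 1 + 1 := rfl
  rw [h10]
  omega

/-- The rows `v`, `u`, `x` form a component, in which `u` and `x` have exactly two common
columns, and these are all the columns meeting `x`. -/
theorem boundHolds_of_path (h : IsSurplusLeafless w A B)
    (hs : ∀ x ∈ A, ∀ y ∈ B, w x y ≠ 0 → w x y = 1) (hu : u ∈ A) (hv : v ∈ A)
    (hne : u ≠ v) {K D : Finset Y} (hK : K = twins w A B u v)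
    (hD : D = B \ K) (hK2 : 2 ≤ K.card) {x : X} (hx : x ∈ A) (hxu : x ≠ u) (hxv : x ≠ v)
    {K' : Finset Y} (hK' : K' = twins w A B u x) (hK'2 : K'.card = 2)
    (hnu : ∀ y ∈ D, w u y ≠ 0 → y ∈ K') (hnv : ∀ y ∈ D, w v y ≠ 0 → y ∈ K')
    (hnx : ∀ y ∈ B, w x y ≠ 0 → y ∈ K')
    (hrest : ∃ z ∈ A, z ≠ u ∧ z ≠ v ∧ z ≠ x)
    (ih : ∀ R E, IsSurplusLeafless w R E → total w R E < total w A B → BoundHolds w R E) :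
    BoundHolds w A B := by
  intro m t b hA hB ht
  have hDB : D ⊆ B := hD ▸ Finset.sdiff_subset
  have hK'B : K' ⊆ B := hK' ▸ twins_subset w A B u x
  have hK'D : K' ⊆ D := by
    intro y hy
    rw [hD]
    refine Finset.mem_sdiff.2 ⟨hK'B hy, fun hyK => ?_⟩
    have hwv := (ne_zero_iff_of_mem_twins (hK ▸ hyK) hv).2 (Or.inr rfl)
    rcases (ne_zero_iff_of_mem_twins (hK' ▸ hy) hv).1 hwv with h1 | h1
    · exact hne h1.symm
    · exact hxv h1.symm
  have hDK := card_sdiff_twins_add w A B u v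
  have htot := total_sdiff (w := w) (twins_subset w A B u v) (fun y hy => sum_col_twins hs hne hy)
  rw [← hK, ← hD] at hDK htot
  have htot' := total_sdiff (w := w) hK'D (fun y hy => sum_col_twins hs hxu.symm (hK' ▸ hy))
  have hDK' := Finset.card_sdiff_add_card_eq_card hK'D
  have hc := card_erase_erase hu hv hne
  have hx12 : x ∈ (A.erase u).erase v := by simp [hx, hxu, hxv]
  have hcx := Finset.card_erase_add_one hx12
  set R := ((A.erase u).erase v).erase x with hR
  set E := D \ K' with hE
  have hmemR : ∀ z, z ∈ R ↔ z ∈ A ∧ z ≠ u ∧ z ≠ v ∧ z ≠ x := by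
    intro z; simp only [hR, Finset.mem_erase]; tauto
  have hEzero : ∀ y ∈ E, w u y = 0 ∧ w v y = 0 ∧ w x y = 0 := by
    intro y hy
    obtain ⟨hyD, hyK'⟩ := Finset.mem_sdiff.1 hy
    refine ⟨?_, ?_, ?_⟩ <;> by_contra hw
    · exact hyK' (hnu y hyD hw)
    · exact hyK' (hnv y hyD hw)
    · exact hyK' (hnx y (hDB hyD) hw)
  have hRA : R ⊆ A := fun z hz => ((hmemR z).1 hz).1
  obtain ⟨hgood, hlt⟩ := h.restrict (R := R) (D := E) hRA
    (fun he => ((hmemR u).1 (he ▸ hu)).2.1 rfl)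
    (by obtain ⟨z, hz⟩ := hrest; exact ⟨z, (hmemR z).2 hz⟩)
    (fun S hS => by
      have hS' : S ⊆ (A.erase u).erase v := hS.trans (Finset.erase_subset _ _)
      rw [← colNbrs_sdiff_twins (B := B) hS', ← hK, ← hD]
      ext y
      simp only [mem_colNbrs, hE, Finset.mem_sdiff]
      constructor
      · rintro ⟨⟨hyD, _⟩, hy⟩; exact ⟨hyD, hy⟩
      · rintro ⟨hyD, z, hz, hwz⟩
        refine ⟨⟨hyD, fun hyK' => ?_⟩, z, hz, hwz⟩
        obtain ⟨hzA, hzu, -, hzx⟩ := (hmemR z).1 (hS hz)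
        rcases (ne_zero_iff_of_mem_twins (hK' ▸ hyK') hzA).1 hwz with h1 | h1
        · exact hzu h1
        · exact hzx h1)
    (fun y hy => by
      obtain ⟨h1, h2, h3⟩ := hEzero y hy
      rw [hR, rowNbrs_erase_of_eq_zero h3, rowNbrs_erase_of_eq_zero h2,
        rowNbrs_erase_of_eq_zero h1]
      exact h.leafless y (hDB (Finset.mem_sdiff.1 hy).1))
  have htotE : total w R E = total w A E := by
    refine Finset.sum_congr rfl fun y hy => Finset.sum_subset hRA fun z hz hzR => ?_
    obtain ⟨h1, h2, h3⟩ := hEzero y hy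
    by_contra hwz
    refine hzR ((hmemR z).2 ⟨hz, ?_, ?_, ?_⟩) <;> rintro rfl <;> contradiction
  have h2 := hgood.two_le
  obtain ⟨m, rfl⟩ : ∃ m', m = m' + 3 := ⟨m - 3, by omega⟩
  obtain ⟨q, hq⟩ : ∃ q, E.card = m + 2 + (q + 1) := ⟨E.card - (m + 3), by omega⟩
  obtain ⟨j, hj⟩ : ∃ j, K.card = j + 2 := ⟨K.card - 2, by omega⟩
  obtain rfl : t = q + 1 + j + 1 := by omega
  have h3 := ih R E hgood (by omega) m (q + 1) b (by omega) hq (by omega)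
  have hstep : ∀ D', ∀ y ∈ K', y ∈ D' → E ⊆ D'.erase y →
      matchCount w R E ≤ matchCount w ((A.erase u).erase v) D' := by
    intro D' y hy hyD' hED'
    rw [matchCount_row w hx12]
    refine le_trans ?_ (Finset.single_le_sum
      (f := fun y => w x y * matchCount w R (D'.erase y)) (fun _ _ => Nat.zero_le _) hyD')
    have hw : w x y ≠ 0 := (ne_zero_iff_of_mem_twins (hK' ▸ hy) hx).2 (Or.inr rfl)
    exact (matchCount_mono w R hED').trans (Nat.le_mul_of_pos_left _ (Nat.pos_of_ne_zero hw))
  have hEsub : ∀ y ∈ K', E ⊆ D.erase y := by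
    intro y hy z hz
    obtain ⟨hzD, hzK'⟩ := Finset.mem_sdiff.1 hz
    exact Finset.mem_erase.2 ⟨fun he => hzK' (he ▸ hy), hzD⟩
  -- `x` may take either column of `K'`.
  have h4 : 2 * matchCount w R E ≤ matchCount w ((A.erase u).erase v) D := by
    rw [matchCount_row w hx12, ← hK'2, ← smul_eq_mul]
    refine le_trans (Finset.card_nsmul_le_sum K'
      (fun y => w x y * matchCount w R (D.erase y)) _ fun y hy => ?_)
      (Finset.sum_le_sum_of_subset hK'D)
    have hw : w x y ≠ 0 := (ne_zero_iff_of_mem_twins (hK' ▸ hy) hx).2 (Or.inr rfl)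
    exact (matchCount_mono w R (hEsub y hy)).trans
      (Nat.le_mul_of_pos_left _ (Nat.pos_of_ne_zero hw))
  have h5 : 2 * matchCount w R E ≤ matchCount w (A.erase v) D := by
    rw [matchCount_row w (Finset.mem_erase.2 ⟨hne, hu⟩ : u ∈ A.erase v), ← hK'2, ← smul_eq_mul,
      Finset.erase_right_comm]
    refine le_trans (Finset.card_nsmul_le_sum K'
      (fun y => w u y * matchCount w ((A.erase u).erase v) (D.erase y)) _ fun y hy => ?_)
      (Finset.sum_le_sum_of_subset hK'D)
    have hw : w u y ≠ 0 := (ne_zero_iff_of_mem_twins (hK' ▸ hy) hu).2 (Or.inl rfl)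
    refine le_trans ?_ (Nat.le_mul_of_pos_left _ (Nat.pos_of_ne_zero hw))
    obtain ⟨y', hy', hyy'⟩ := Finset.exists_mem_ne (by omega : 1 < K'.card) y
    refine hstep _ y' hy' (Finset.mem_erase.2 ⟨hyy', hK'D hy'⟩) fun z hz => ?_
    have h6 := Finset.mem_erase.1 (hEsub y' hy' hz)
    exact Finset.mem_erase.2 ⟨h6.1, hEsub y hy hz⟩
  rw [matchCount_twins hs hu hv hne hK hD, hj]
  have h6 : j + 2 - 1 = j + 1 := rfl
  rw [h6]
  calc ((m + 3 + 1) * (q + 1 + j + 1) + 2 + b) * (q + 1 + j + 1 + 1)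
      ≤ 2 * (j + 2) ^ 2 * (((m + 1) * (q + 1) + 2 + b) * (q + 1 + 1)) := path_arith m q b j
    _ ≤ 2 * (j + 2) ^ 2 * matchCount w R E := Nat.mul_le_mul_left _ h3
    _ = (j + 2) * (2 * matchCount w R E) + (j + 2) * (j + 1) * (2 * matchCount w R E) := by ring
    _ ≤ (j + 2) * matchCount w (A.erase v) D +
        (j + 2) * (j + 1) * matchCount w ((A.erase u).erase v) D :=
      Nat.add_le_add (Nat.mul_le_mul_left _ h5) (Nat.mul_le_mul_left _ h4)
    _ ≤ _ := by
      rw [mul_add (j + 2) (matchCount w (A.erase u) D)]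
      omega

/-- A tight set that covers all but the twin columns of `u` and `v` excludes witnesses. -/
theorem not_isWitness_of_cover (h : IsSurplusLeafless w A B) (hlt : A.card < B.card)
    (hv : v ∈ A) {K F : Finset Y} (hKB : K ⊆ B)
    (hKu : ∀ y ∈ K, w u y ≠ 0) (hvF : colNbrs w B {v} ⊆ K ∪ F) (hF : F ⊆ colNbrs w B {u, v})
    {S T : Finset X} (hS : S ⊆ A) (huS : u ∉ S) (hvS : v ∉ S)
    (hScard : (colNbrs w B S).card = S.card + 1) (hFS : F ⊆ colNbrs w B S) (hF2 : 2 ≤ F.card)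
    {y : Y} (hy : y ∈ F) (hwu : w u y ≠ 0) (hT : IsWitness w A B u y T) : False := by
  have hyT : y ∈ colNbrs w B T := mem_colNbrs.2 ⟨(mem_colNbrs.1 (hF hy)).1, u, hT.mem, hwu⟩
  have hsub : T ∪ S ⊆ A := Finset.union_subset hT.subset hS
  have h1 := card_colNbrs_union w B T S
  have h2 := Finset.card_union_add_card_inter T S
  have h3 := h.surplus_of_lt hlt hsub ⟨u, Finset.mem_union_left _ hT.mem⟩
  have h4 := hT.card_eq
  have hyi : y ∈ colNbrs w B T ∩ colNbrs w B S := Finset.mem_inter.2 ⟨hyT, hFS hy⟩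
  rcases (T ∩ S).eq_empty_or_nonempty with he | hne
  · rw [he, Finset.card_empty] at h2
    -- For disjoint `T` and `S`: if `v ∈ T`, both see all of `F`, and two common columns destroy the
    -- surplus of the union. If not, they share `y`, and adding `v` to the union brings no new
    -- column.
    by_cases hvT : v ∈ T
    · have h5 : F ⊆ colNbrs w B T ∩ colNbrs w B S := Finset.subset_inter
        (hF.trans (colNbrs_mono w B
          (Finset.insert_subset hT.mem (Finset.singleton_subset_iff.2 hvT)))) hFS
      have h6 := Finset.card_le_card h5
      omega
    · have h5 := Finset.card_pos.2 ⟨y, hyi⟩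
      have hvTS : v ∉ T ∪ S := fun hm => (Finset.mem_union.1 hm).elim hvT hvS
      have h6 := h.surplus_of_lt hlt (Finset.insert_subset hv hsub)
        ⟨v, Finset.mem_insert_self _ _⟩
      have hle : colNbrs w B {v} ⊆ colNbrs w B (T ∪ S) := by
        intro z hz
        rw [colNbrs_union]
        rcases Finset.mem_union.1 (hvF hz) with hzK | hzF
        · exact Finset.mem_union_left _ (mem_colNbrs.2 ⟨hKB hzK, u, hT.mem, hKu z hzK⟩)
        · exact Finset.mem_union_right _ (hFS hzF)
      rw [Finset.card_insert_of_notMem hvTS, Finset.insert_eq, colNbrs_union w B {v},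
        Finset.union_eq_right.2 hle] at h6
      omega
  · have h5 := h.surplus_of_lt hlt (Finset.inter_subset_left.trans hT.subset) hne
    -- `T` sees `y` only through `u`, which is not in `S`. So N(T) ∩ N(S) exceeds |T ∩ S| by at
    -- least two, and the union loses its surplus.
    have hynot : y ∉ colNbrs w B (T ∩ S) := by
      intro hm
      obtain ⟨_, z, hz, hwz⟩ := mem_colNbrs.1 hm
      obtain ⟨hzT, hzS⟩ := Finset.mem_inter.1 hz
      exact huS (hT.eq_of_mem z hzT hwz ▸ hzS)
    have h6 := Finset.card_le_card (Finset.insert_subset hyi (colNbrs_inter_subset w B T S))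
    rw [Finset.card_insert_of_notMem hynot] at h6
    omega

end SmallBoundary

/-! ### Analysis of a failed merge and the main induction -/

section Main

variable {X Y : Type*} [DecidableEq X] [DecidableEq Y]
variable {w : X → Y → ℕ} {A : Finset X} {B : Finset Y} {u v : X}

theorem mem_sdiff_twins_of_mem_twins (hv : v ∈ A) (hne : u ≠ v) {x : X} (hxv : x ≠ v) {y : Y}
    (hy : y ∈ twins w A B u x) : y ∈ B \ twins w A B u v := by
  refine Finset.mem_sdiff.2 ⟨twins_subset w A B u x hy, fun hyK => ?_⟩
  have hwv := (ne_zero_iff_of_mem_twins hyK hv).2 (Or.inr rfl)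
  rcases (ne_zero_iff_of_mem_twins hy hv).1 hwv with h1 | h1
  · exact hne h1.symm
  · exact hxv h1.symm

theorem mem_twins_of_card_eq_two {x : X} {y : Y} (hy : y ∈ B) (hc : (rowNbrs w A y).card = 2)
    (hu : u ∈ A) (hx : x ∈ A) (hne : u ≠ x) (hwu : w u y ≠ 0) (hwx : w x y ≠ 0) :
    y ∈ twins w A B u x := by
  refine mem_twins.2 ⟨hy, (Finset.eq_of_subset_of_card_le (Finset.insert_subset
    (mem_rowNbrs.2 ⟨hu, hwu⟩) (Finset.singleton_subset_iff.2 (mem_rowNbrs.2 ⟨hx, hwx⟩))) ?_).symm⟩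
  rw [hc, Finset.card_pair hne]

/-- Since no witness exists for the edge uy, the column `y` has degree two, with second neighbour `x
∈ S`. The twins of `u` and `x` then shrink `S` to {x}, which is the three-row configuration. -/
theorem boundHolds_of_cover (h : IsSurplusLeafless w A B) (hlt : A.card < B.card)
    (hs : ∀ x ∈ A, ∀ y ∈ B, w x y ≠ 0 → w x y = 1)
    (hW : ∀ x ∈ A, ∀ y ∈ B, w x y ≠ 0 →
      (rowNbrs w A y).card = 2 ∨ ∃ S, IsWitness w A B x y S)
    (htw : ∀ a ∈ A, ∀ b ∈ A, a ≠ b → (twins w A B a b).Nonempty → 2 ≤ (twins w A B a b).card)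
    (hu : u ∈ A) (hv : v ∈ A) (hne : u ≠ v) {K D : Finset Y} (hK : K = twins w A B u v)
    (hD : D = B \ K) (hK2 : 2 ≤ K.card) {S : Finset X} (hS : S ⊆ A)
    (huS : u ∉ S) (hvS : v ∉ S) (hScard : (colNbrs w B S).card = S.card + 1)
    (hFS : colNbrs w D {u, v} ⊆ colNbrs w B S) (hF2 : 2 ≤ (colNbrs w D {u, v}).card)
    (hrest : ∃ z ∈ A, z ∉ S ∧ z ≠ u ∧ z ≠ v) {y : Y} (hyD : y ∈ D) (hwu : w u y ≠ 0)
    (ih : ∀ R E, IsSurplusLeafless w R E → total w R E < total w A B → BoundHolds w R E) :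
    BoundHolds w A B := by
  have hDB : D ⊆ B := hD ▸ Finset.sdiff_subset
  have hKB : K ⊆ B := hK ▸ twins_subset w A B u v
  have hyF : y ∈ colNbrs w D {u, v} := mem_colNbrs.2 ⟨hyD, u, by simp, hwu⟩
  have hdeg : (rowNbrs w A y).card = 2 := by
    refine (hW u hu y (hDB hyD) hwu).resolve_right ?_
    rintro ⟨T, hT⟩
    refine not_isWitness_of_cover h hlt hv hKB
      (fun z hz => (ne_zero_iff_of_mem_twins (hK ▸ hz) hu).2 (Or.inl rfl)) ?_ ?_
      hS huS hvS hScard hFS hF2 hyF hwu hT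
    · intro z hz
      obtain ⟨hzB, x, hx, hwz⟩ := mem_colNbrs.1 hz
      by_cases hzK : z ∈ K
      · exact Finset.mem_union_left _ hzK
      · refine Finset.mem_union_right _ (mem_colNbrs.2
          ⟨hD ▸ Finset.mem_sdiff.2 ⟨hzB, hzK⟩, x, ?_, hwz⟩)
        exact Finset.mem_insert_of_mem hx
    · intro z hz
      obtain ⟨hzD, hx⟩ := mem_colNbrs.1 hz
      exact mem_colNbrs.2 ⟨hDB hzD, hx⟩
  obtain ⟨_, x, hxS, hwx⟩ := mem_colNbrs.1 (hFS hyF)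
  have hxA := hS hxS
  have hxu : x ≠ u := fun he => huS (he ▸ hxS)
  have hxv : x ≠ v := fun he => hvS (he ▸ hxS)
  have hyK' : y ∈ twins w A B u x :=
    mem_twins_of_card_eq_two (hDB hyD) hdeg hu hxA hxu.symm hwu hwx
  have hK'2 := htw u hu x hxA hxu.symm ⟨y, hyK'⟩
  have hK'sub : twins w A B u x ⊆ colNbrs w B S := fun z hz =>
    mem_colNbrs.2 ⟨twins_subset w A B u x hz, x, hxS,
      (ne_zero_iff_of_mem_twins hz hxA).2 (Or.inr rfl)⟩
  -- At least two columns, the twins of `u` and `x`, are seen by `S` only through `x`; the other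
  -- rows of `S` would have no surplus.
  have hSx : S = {x} := by
    by_contra hSx
    have hne' : (S.erase x).Nonempty := by
      rw [Finset.nonempty_iff_ne_empty]
      intro he
      rcases (Finset.erase_eq_empty_iff S x).1 he with h0 | h0
      · simp [h0] at hxS
      · exact hSx h0
    have h1 := h.surplus_of_lt hlt ((Finset.erase_subset x S).trans hS) hne'
    have h2 : colNbrs w B (S.erase x) ⊆ colNbrs w B S \ twins w A B u x := by
      intro z hz
      obtain ⟨hzB, x', hx', hwz⟩ := mem_colNbrs.1 hz
      obtain ⟨hxx', hxS'⟩ := Finset.mem_erase.1 hx'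
      refine Finset.mem_sdiff.2 ⟨mem_colNbrs.2 ⟨hzB, x', hxS', hwz⟩, fun hzK' => ?_⟩
      rcases (ne_zero_iff_of_mem_twins hzK' (hS hxS')).1 hwz with h3 | h3
      · exact huS (h3 ▸ hxS')
      · exact hxx' h3
    have h3 := Finset.card_le_card h2
    rw [Finset.card_sdiff_of_subset hK'sub] at h3
    have h4 := Finset.card_erase_add_one hxS
    omega
  subst hSx
  rw [Finset.card_singleton] at hScard
  have hK'eq := Finset.eq_of_subset_of_card_le hK'sub (by omega)
  have hFK' : ∀ z ∈ D, ∀ a ∈ ({u, v} : Finset X), w a z ≠ 0 → z ∈ twins w A B u x := by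
    intro z hz a ha hwz
    rw [hK'eq]
    exact hFS (mem_colNbrs.2 ⟨hz, a, ha, hwz⟩)
  refine boundHolds_of_path h hs hu hv hne hK hD hK2 hxA hxu hxv rfl
    (by rw [hK'eq, hScard]) (fun z hz => hFK' z hz u (by simp))
    (fun z hz => hFK' z hz v (by simp)) (fun z hz hwz => ?_) ?_ ih
  · rw [hK'eq]
    exact mem_colNbrs.2 ⟨hz, x, hxS, hwz⟩
  · obtain ⟨z, hzA, hzS, hzu, hzv⟩ := hrest
    exact ⟨z, hzA, hzu, hzv, fun he => hzS (by simp [he])⟩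

theorem boundHolds_of_single (h : IsSurplusLeafless w A B) (hlt : A.card < B.card)
    (hs : ∀ x ∈ A, ∀ y ∈ B, w x y ≠ 0 → w x y = 1)
    (hW : ∀ x ∈ A, ∀ y ∈ B, w x y ≠ 0 →
      (rowNbrs w A y).card = 2 ∨ ∃ S, IsWitness w A B x y S)
    (htw : ∀ a ∈ A, ∀ b ∈ A, a ≠ b → (twins w A B a b).Nonempty → 2 ≤ (twins w A B a b).card)
    (hA3 : 3 ≤ A.card) (hu : u ∈ A) (hv : v ∈ A) (hne : u ≠ v) {K D : Finset Y}
    (hK : K = twins w A B u v) (hD : D = B \ K) (hK2 : 2 ≤ K.card) {y : Y}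
    (hF : colNbrs w D {u, v} = {y}) (hwu : w u y ≠ 0)
    (ih : ∀ R E, IsSurplusLeafless w R E → total w R E < total w A B → BoundHolds w R E) :
    BoundHolds w A B := by
  have hDB : D ⊆ B := hD ▸ Finset.sdiff_subset
  have hKB : K ⊆ B := hK ▸ twins_subset w A B u v
  have hyD : y ∈ D := (mem_colNbrs.1 (hF.symm ▸ Finset.mem_singleton_self y)).1
  have huniq : ∀ z ∈ D, ∀ a ∈ ({u, v} : Finset X), w a z ≠ 0 → z = y := by
    intro z hz a ha hwz
    have : z ∈ colNbrs w D {u, v} := mem_colNbrs.2 ⟨hz, a, ha, hwz⟩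
    rw [hF] at this
    exact Finset.mem_singleton.1 this
  -- A column of degree two would have a twin by `htw`, which would be a second column of `D` at
  -- `u`.
  have hdeg : (rowNbrs w A y).card ≠ 2 := by
    intro hc
    obtain ⟨x, hxA, hxu, hxv, hwx⟩ := exists_third h (hK ▸ hD ▸ hyD)
    have hyK' := mem_twins_of_card_eq_two (hDB hyD) hc hu hxA hxu.symm hwu hwx
    obtain ⟨z, hz, hzy⟩ := Finset.exists_mem_ne (htw u hu x hxA hxu.symm ⟨y, hyK'⟩) y
    have hzD := mem_sdiff_twins_of_mem_twins hv hne hxv hz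
    rw [← hK, ← hD] at hzD
    exact hzy (huniq z hzD u (by simp) ((ne_zero_iff_of_mem_twins hz hu).2 (Or.inl rfl)))
  -- Otherwise a witness `T` for the edge uy omits `v` but sees all columns of `v`, so adding `v`
  -- violates surplus.
  have hwv : w v y = 0 := by
    by_contra hwv
    obtain ⟨T, hT⟩ := (hW u hu y (hDB hyD) hwu).resolve_left hdeg
    have hvT : v ∉ T := fun hm => hne (hT.eq_of_mem v hm hwv).symm
    have hle : colNbrs w B {v} ⊆ colNbrs w B T := by
      intro z hz
      obtain ⟨hzB, x, hx, hwz⟩ := mem_colNbrs.1 hz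
      rw [Finset.mem_singleton.1 hx] at hwz
      refine mem_colNbrs.2 ⟨hzB, u, hT.mem, ?_⟩
      by_cases hzK : z ∈ K
      · exact (ne_zero_iff_of_mem_twins (hK ▸ hzK) hu).2 (Or.inl rfl)
      · rw [huniq z (hD ▸ Finset.mem_sdiff.2 ⟨hzB, hzK⟩) v (by simp) hwz]
        exact hwu
    have h1 := h.surplus_of_lt hlt (Finset.insert_subset hv hT.subset)
      ⟨v, Finset.mem_insert_self _ _⟩
    rw [Finset.card_insert_of_notMem hvT, Finset.insert_eq, colNbrs_union,
      Finset.union_eq_right.2 hle, hT.card_eq] at h1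
    omega
  have h2 := h.leafless y (hDB hyD)
  refine boundHolds_of_bridge h hs hu hv hne hA3 hK hD hK2 hyD hwu (by omega)
    (fun z hz hzy => ?_) (fun z hz => ?_) (ih _ _)
  · by_contra hw
    exact hzy (huniq z hz u (by simp) hw)
  · by_contra hw
    rw [huniq z hz v (by simp) hw] at hw
    exact hw hwv

/-- The cases are by the number of columns outside `K` that meet `u` or `v`: none, one, or at least
two. -/
theorem boundHolds_of_not_merge (h : IsSurplusLeafless w A B)
    (hs : ∀ x ∈ A, ∀ y ∈ B, w x y ≠ 0 → w x y = 1)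
    (hW : ∀ x ∈ A, ∀ y ∈ B, w x y ≠ 0 →
      (rowNbrs w A y).card = 2 ∨ ∃ S, IsWitness w A B x y S)
    (htw : ∀ a ∈ A, ∀ b ∈ A, a ≠ b → (twins w A B a b).Nonempty → 2 ≤ (twins w A B a b).card)
    (hA3 : 3 ≤ A.card) (hu : u ∈ A) (hv : v ∈ A) (hne : u ≠ v) {K D : Finset Y}
    (hK : K = twins w A B u v) (hD : D = B \ K) (hK2 : 2 ≤ K.card) {S : Finset X} (hSA : S ⊆ A)
    (huS : u ∈ S) (hvS : v ∈ S) (hneA : S ≠ A)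
    (hSlt : (colNbrs w B S).card < S.card + K.card)
    (ih : ∀ R E, IsSurplusLeafless w R E → total w R E < total w A B → BoundHolds w R E) :
    BoundHolds w A B := by
  have hDB : D ⊆ B := hD ▸ Finset.sdiff_subset
  have hKB : K ⊆ B := hK ▸ twins_subset w A B u v
  have hDK := card_sdiff_twins_add w A B u v
  have hDc := card_lt_card_sdiff_twins h hu hv hne hA3
  rw [← hK, ← hD] at hDK hDc
  have hlt : A.card < B.card := by omega
  have hZ : (colNbrs w D S).card + K.card ≤ (colNbrs w B S).card := by
    rw [← Finset.card_union_of_disjoint]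
    · refine Finset.card_le_card (Finset.union_subset (fun y hy => ?_) fun y hy => ?_)
      · obtain ⟨hyD, hx⟩ := mem_colNbrs.1 hy
        exact mem_colNbrs.2 ⟨hDB hyD, hx⟩
      · exact mem_colNbrs.2 ⟨hKB hy, u, huS,
          (ne_zero_iff_of_mem_twins (hK ▸ hy) hu).2 (Or.inl rfl)⟩
    · rw [Finset.disjoint_left]
      intro y hy hyK
      have hyD := (mem_colNbrs.1 hy).1
      rw [hD] at hyD
      exact (Finset.mem_sdiff.1 hyD).2 hyK
  have hcS := card_erase_erase huS hvS hne
  have hFZ : colNbrs w D {u, v} ⊆ colNbrs w D S :=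
    colNbrs_mono w D (Finset.insert_subset huS (Finset.singleton_subset_iff.2 hvS))
  have hadj : ∀ y ∈ colNbrs w D {u, v}, y ∈ D ∧ (w u y ≠ 0 ∨ w v y ≠ 0) := by
    intro y hy
    obtain ⟨hyD, x, hx, hw⟩ := mem_colNbrs.1 hy
    simp only [Finset.mem_insert, Finset.mem_singleton] at hx
    rcases hx with rfl | rfl
    · exact ⟨hyD, Or.inl hw⟩
    · exact ⟨hyD, Or.inr hw⟩
  have hK' : K = twins w A B v u := by rw [hK, twins_comm]
  have hcases : (colNbrs w D {u, v}).card = 0 ∨ (colNbrs w D {u, v}).card = 1 ∨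
      2 ≤ (colNbrs w D {u, v}).card := by omega
  rcases hcases with hF | hF | hF
  · rw [Finset.card_eq_zero] at hF
    refine boundHolds_of_isolated h hs hu hv hne hA3 hK hD (fun y hy => ?_) (fun y hy => ?_)
      (ih _ _)
    · by_contra hw
      have : y ∈ colNbrs w D {u, v} := mem_colNbrs.2 ⟨hy, u, by simp, hw⟩
      simp [hF] at this
    · by_contra hw
      have : y ∈ colNbrs w D {u, v} := mem_colNbrs.2 ⟨hy, v, by simp, hw⟩
      simp [hF] at this
  · obtain ⟨y, hy⟩ := Finset.card_eq_one.1 hF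
    rcases (hadj y (by simp [hy])).2 with hw | hw
    · exact boundHolds_of_single h hlt hs hW htw hA3 hu hv hne hK hD hK2 hy hw ih
    · exact boundHolds_of_single h hlt hs hW htw hA3 hv hu hne.symm hK' hD hK2
        (by rw [Finset.pair_comm]; exact hy) hw ih
  · set S' := (S.erase u).erase v with hS'
    have hS'sub : S' ⊆ (A.erase u).erase v :=
      Finset.erase_subset_erase v (Finset.erase_subset_erase u hSA)
    have hS'A : S' ⊆ A := (Finset.erase_subset _ _).trans ((Finset.erase_subset _ _).trans hSA)
    have hcF := Finset.card_le_card hFZ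
    have hS'ne : S'.Nonempty := Finset.card_pos.1 (by omega)
    have h1 := h.surplus_of_lt hlt hS'A hS'ne
    have hcol : colNbrs w D S' = colNbrs w B S' := by rw [hD, hK, colNbrs_sdiff_twins hS'sub]
    have h2 : colNbrs w B S' ⊆ colNbrs w D S := by
      rw [← hcol]
      exact colNbrs_mono w D ((Finset.erase_subset _ _).trans (Finset.erase_subset _ _))
    -- The obstruction gives |N(S) ∩ D| ≤ |S| - 1 = |S'| + 1, and surplus of `S'` gives |N(S')| ≥
    -- |S'| + 1. Hence N(S') is all of N(S) ∩ D, including the outside neighbours of `u` and `v`.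
    have h3 := Finset.eq_of_subset_of_card_le h2 (by omega)
    have h4 := congrArg Finset.card h3
    have hS'card : (colNbrs w B S').card = S'.card + 1 := by omega
    obtain ⟨z, hzA, hzS⟩ := Finset.exists_of_ssubset
      ((Finset.ssubset_iff_subset_ne).2 ⟨hSA, hneA⟩)
    have hzu : z ≠ u := fun he => hzS (he ▸ huS)
    have hzv : z ≠ v := fun he => hzS (he ▸ hvS)
    have hzS' : z ∉ S' := fun hm => hzS (Finset.mem_of_mem_erase (Finset.mem_of_mem_erase hm))
    have huS' : u ∉ S' := by simp [hS']
    have hvS' : v ∉ S' := by simp [hS']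
    obtain ⟨y, hy⟩ := Finset.card_pos.1 (by omega : 0 < (colNbrs w D {u, v}).card)
    obtain ⟨hyD, hw | hw⟩ := hadj y hy
    · exact boundHolds_of_cover h hlt hs hW htw hu hv hne hK hD hK2 hS'A huS' hvS' hS'card
        (h3 ▸ hFZ) hF ⟨z, hzA, hzS', hzu, hzv⟩ hyD hw ih
    · exact boundHolds_of_cover h hlt hs hW htw hv hu hne.symm hK' hD hK2 hS'A hvS' huS' hS'card
        (by rw [Finset.pair_comm]; exact h3 ▸ hFZ) (by rw [Finset.pair_comm]; exact hF)
        ⟨z, hzA, hzS', hzv, hzu⟩ hyD hw ih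

theorem IsSurplusLeafless.boundHolds (h : IsSurplusLeafless w A B) : BoundHolds w A B := by
  induction hN : total w A B using Nat.strong_induction_on generalizing w A B with
  | _ N IH =>
    subst hN
    have ih : ∀ (w' : X → Y → ℕ) R E, IsSurplusLeafless w' R E →
        total w' R E < total w A B → BoundHolds w' R E := fun w' R E h' hlt => IH _ hlt h' rfl
    by_cases hred : ∃ x ∈ A, ∃ y ∈ B, w x y ≠ 0 ∧ IsSurplusLeafless (lowerEntry w x y) A B
    · obtain ⟨x, hx, y, hy, hw, hl⟩ := hred
      refine boundHolds_of_lowerEntry h hx hy hw hl (ih _ _ _ hl ?_)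
      have := total_lowerEntry hx hy hw
      omega
    push Not at hred
    have hs : ∀ x ∈ A, ∀ y ∈ B, w x y ≠ 0 → w x y = 1 := fun x hx y hy hw =>
      (h.critical hy hw (hred x hx y hy hw)).1
    have hW : ∀ x ∈ A, ∀ y ∈ B, w x y ≠ 0 →
        (rowNbrs w A y).card = 2 ∨ ∃ S, IsWitness w A B x y S := fun x hx y hy hw =>
      (h.critical hy hw (hred x hx y hy hw)).2
    by_cases hA2 : A.card = 2
    · exact boundHolds_of_card_eq_two h hs hA2
    have hA3 : 3 ≤ A.card := by have := h.two_le; omega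
    have hmerge : ∀ u ∈ A, ∀ v ∈ A, u ≠ v → (twins w A B u v).Nonempty →
        (∀ S ⊆ A, u ∈ S → v ∈ S → S ≠ A →
          S.card + (twins w A B u v).card ≤ (colNbrs w B S).card) → BoundHolds w A B := by
      intro u hu v hv hne hKne hm
      refine boundHolds_of_mergeRows h hs hu hv hne hA3 rfl rfl hKne (ih _ _ _
        (isSurplusLeafless_mergeRows h hu hv hne hA3 rfl rfl hm) ?_)
      rw [total_mergeRows w _ hu hv hne]
      have htot := total_sdiff (w := w) (twins_subset w A B u v)
        (fun y hy => sum_col_twins hs hne hy)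
      have := Finset.card_pos.2 hKne
      omega
    by_cases htw : ∀ a ∈ A, ∀ b ∈ A, a ≠ b → (twins w A B a b).Nonempty →
        2 ≤ (twins w A B a b).card
    · obtain ⟨y, hy, hc⟩ := exists_card_rowNbrs_eq_two h hW
      obtain ⟨u, v, hne, hrow⟩ := Finset.card_eq_two.1 hc
      have hu : u ∈ A := (mem_rowNbrs.1 (hrow.symm ▸ by simp : u ∈ rowNbrs w A y)).1
      have hv : v ∈ A := (mem_rowNbrs.1 (hrow.symm ▸ by simp : v ∈ rowNbrs w A y)).1
      have hKne : (twins w A B u v).Nonempty := ⟨y, mem_twins.2 ⟨hy, hrow⟩⟩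
      by_cases hm : ∀ S ⊆ A, u ∈ S → v ∈ S → S ≠ A →
          S.card + (twins w A B u v).card ≤ (colNbrs w B S).card
      · exact hmerge u hu v hv hne hKne hm
      · push Not at hm
        obtain ⟨S, hSA, huS, hvS, hneA, hlt⟩ := hm
        exact boundHolds_of_not_merge h hs hW htw hA3 hu hv hne rfl rfl
          (htw u hu v hv hne hKne) hSA huS hvS hneA hlt (ih w)
    -- For a single twin column the merging condition is just the surplus of `S`.
    · push Not at htw
      obtain ⟨u, hu, v, hv, hne, hKne, hK⟩ := htw
      refine hmerge u hu v hv hne hKne fun S hSA huS _ hneA => ?_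
      have := h.surplus S hSA ⟨u, huS⟩ hneA
      omega

end Main

/-! ### From multigraphs to multiplicity matrices -/

section Multiplicity

variable {X Y E : Type*} [DecidableEq X] [DecidableEq Y] [Fintype E]

/-- The number of edges between `x` and `y`. -/
def mult (G : Bigraph X Y E) (x : X) (y : Y) : ℕ :=
  (Finset.univ.filter fun e => G.left e = x ∧ G.right e = y).card

theorem mult_ne_zero {G : Bigraph X Y E} {x : X} {y : Y} :
    G.mult x y ≠ 0 ↔ ∃ e, G.left e = x ∧ G.right e = y := by
  simp [mult, Finset.filter_eq_empty_iff]

theorem sum_edges_eq_sum_mult (G : Bigraph X Y E) (x : X) (B : Finset Y) (c : Y → ℕ) :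
    ∑ e with G.left e = x ∧ G.right e ∈ B, c (G.right e) = ∑ y ∈ B, G.mult x y * c y := by
  rw [← Finset.sum_fiberwise_of_maps_to (g := G.right) (t := B)
    (fun e he => (Finset.mem_filter.1 he).2.2)]
  refine Finset.sum_congr rfl fun y hy => ?_
  rw [Finset.sum_congr rfl (g := fun _ => c y)
    (fun e he => by rw [(Finset.mem_filter.1 he).2]), Finset.sum_const, smul_eq_mul]
  congr 2
  ext e
  simp only [Finset.mem_filter, Finset.mem_univ, true_and]
  constructor
  · rintro ⟨⟨h1, _⟩, h2⟩; exact ⟨h1, h2⟩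
  · rintro ⟨h1, h2⟩; exact ⟨⟨h1, h2 ▸ hy⟩, h2⟩

variable [DecidableEq E]

open Classical in
/-- The matchings that cover exactly the rows `A` and use only the columns `B`. -/
noncomputable def matchingsOn (G : Bigraph X Y E) (A : Finset X) (B : Finset Y) :
    Finset (Finset E) :=
  {M | G.IsMatching M ∧ M.image G.left = A ∧ M.image G.right ⊆ B}

theorem mem_matchingsOn {G : Bigraph X Y E} {A : Finset X} {B : Finset Y} {M : Finset E} :
    M ∈ G.matchingsOn A B ↔ G.IsMatching M ∧ M.image G.left = A ∧ M.image G.right ⊆ B := by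
  simp [matchingsOn]

theorem IsMatching.left_injOn {G : Bigraph X Y E} {M : Finset E} (h : G.IsMatching M) :
    Set.InjOn G.left M := by
  intro e he f hf hef
  by_contra hne
  exact (h e he f hf hne).1 hef

theorem erase_mem_matchingsOn {G : Bigraph X Y E} {a : X} {s : Finset X} (ha : a ∉ s)
    {B : Finset Y} {M : Finset E} (hM : M ∈ G.matchingsOn (insert a s) B) {e : E} (he : e ∈ M)
    (hea : G.left e = a) : M.erase e ∈ G.matchingsOn s (B.erase (G.right e)) := by
  obtain ⟨hm, hl, hr⟩ := mem_matchingsOn.1 hM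
  refine mem_matchingsOn.2 ⟨fun f hf g hg => hm f (Finset.mem_of_mem_erase hf) g
    (Finset.mem_of_mem_erase hg), ?_, ?_⟩
  · ext x
    simp only [Finset.mem_image, Finset.mem_erase]
    constructor
    · rintro ⟨f, ⟨hfe, hf⟩, rfl⟩
      have h1 : G.left f ∈ insert a s := hl ▸ Finset.mem_image_of_mem _ hf
      rcases Finset.mem_insert.1 h1 with h2 | h2
      · exact absurd (h2.trans hea.symm) (hm f hf e he hfe).1
      · exact h2
    · intro hx
      have h1 : x ∈ M.image G.left := hl ▸ Finset.mem_insert_of_mem hx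
      obtain ⟨f, hf, rfl⟩ := Finset.mem_image.1 h1
      exact ⟨f, ⟨fun hfe => ha (hea ▸ hfe ▸ hx), hf⟩, rfl⟩
  · intro y hy
    obtain ⟨f, hf, rfl⟩ := Finset.mem_image.1 hy
    obtain ⟨hfe, hf⟩ := Finset.mem_erase.1 hf
    exact Finset.mem_erase.2 ⟨(hm f hf e he hfe).2, hr (Finset.mem_image_of_mem _ hf)⟩

theorem insert_mem_matchingsOn {G : Bigraph X Y E} {a : X} {s : Finset X} (ha : a ∉ s)
    {B : Finset Y} {M : Finset E} {e : E} (hM : M ∈ G.matchingsOn s (B.erase (G.right e)))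
    (hea : G.left e = a) (heB : G.right e ∈ B) :
    e ∉ M ∧ insert e M ∈ G.matchingsOn (insert a s) B := by
  obtain ⟨hm, hl, hr⟩ := mem_matchingsOn.1 hM
  have h1 : ∀ f ∈ M, G.left e ≠ G.left f := fun f hf he =>
    ha (hl ▸ hea ▸ he ▸ Finset.mem_image_of_mem _ hf)
  have h2 : ∀ f ∈ M, G.right e ≠ G.right f := fun f hf he =>
    (Finset.mem_erase.1 (hr (Finset.mem_image_of_mem _ hf))).1 he.symm
  refine ⟨fun he => h1 e he rfl, mem_matchingsOn.2 ⟨?_, ?_, ?_⟩⟩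
  · intro f hf g hg hfg
    rcases Finset.mem_insert.1 hf with rfl | hf' <;>
      rcases Finset.mem_insert.1 hg with rfl | hg'
    · exact absurd rfl hfg
    · exact ⟨h1 g hg', h2 g hg'⟩
    · exact ⟨(h1 f hf').symm, (h2 f hf').symm⟩
    · exact hm f hf' g hg' hfg
  · rw [Finset.image_insert, hl, hea]
  · rw [Finset.image_insert]
    exact Finset.insert_subset heB (hr.trans (Finset.erase_subset _ _))

theorem card_matchingsOn (G : Bigraph X Y E) (A : Finset X) (B : Finset Y) :
    (G.matchingsOn A B).card = matchCount G.mult A B := by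
  induction A using Finset.induction_on generalizing B with
  | empty =>
    rw [matchCount_empty, Finset.card_eq_one]
    refine ⟨∅, ?_⟩
    ext M
    rw [mem_matchingsOn, Finset.mem_singleton, Finset.image_eq_empty]
    constructor
    · exact fun h => h.2.1
    · rintro rfl
      exact ⟨fun e he => absurd he (Finset.notMem_empty e), rfl, by simp⟩
  | insert a s ha ih =>
    rw [matchCount_insert _ ha, ← sum_edges_eq_sum_mult, Finset.card_eq_sum_ones]
    have h1 : ∀ M ∈ G.matchingsOn (insert a s) B,
        ((Finset.univ.filter fun e => G.left e = a ∧ G.right e ∈ B).bipartiteAbove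
          (fun M e => e ∈ M) M).card = 1 := by
      intro M hM
      obtain ⟨hm, hl, hr⟩ := mem_matchingsOn.1 hM
      have h2 : a ∈ M.image G.left := hl ▸ Finset.mem_insert_self a s
      obtain ⟨e, he, hea⟩ := Finset.mem_image.1 h2
      rw [Finset.card_eq_one]
      refine ⟨e, ?_⟩
      ext f
      simp only [Finset.bipartiteAbove, Finset.mem_filter, Finset.mem_univ, true_and,
        Finset.mem_singleton]
      constructor
      · rintro ⟨⟨hfa, _⟩, hf⟩
        exact hm.left_injOn hf he (hfa.trans hea.symm)
      · rintro rfl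
        exact ⟨⟨hea, hr (Finset.mem_image_of_mem _ he)⟩, he⟩
    -- Each matching has exactly one edge at `a`, so matchings may be counted through that edge.
    rw [← Finset.sum_congr rfl h1, Finset.sum_card_bipartiteAbove_eq_sum_card_bipartiteBelow]
    refine Finset.sum_congr rfl fun e he => ?_
    obtain ⟨hea, heB⟩ := (Finset.mem_filter.1 he).2
    rw [← ih]
    refine Finset.card_nbij' (fun M => M.erase e) (fun M => insert e M) ?_ ?_ ?_ ?_
    · intro M hM
      obtain ⟨hM, heM⟩ := Finset.mem_filter.1 hM
      exact erase_mem_matchingsOn ha hM heM hea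
    · intro M hM
      exact Finset.mem_filter.2 ⟨(insert_mem_matchingsOn ha hM hea heB).2,
        Finset.mem_insert_self _ _⟩
    · intro M hM
      exact Finset.insert_erase (Finset.mem_filter.1 hM).2
    · intro M hM
      exact Finset.erase_insert (insert_mem_matchingsOn ha hM hea heB).1

variable [Fintype X] [Fintype Y]

/-- Once a matching saturates X, being maximum means saturating X. -/
theorem Phi_eq_matchCount (G : Bigraph X Y E)
    (h : 0 < matchCount G.mult Finset.univ Finset.univ) :
    G.Phi = matchCount G.mult Finset.univ Finset.univ := by
  rw [← card_matchingsOn] at h ⊢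
  obtain ⟨M₀, hM₀⟩ := Finset.card_pos.1 h
  obtain ⟨hm₀, hl₀, _⟩ := mem_matchingsOn.1 hM₀
  have hcard : ∀ M, G.IsMatching M → M.card = (M.image G.left).card := fun M hM =>
    (Finset.card_image_of_injOn hM.left_injOn).symm
  unfold Phi
  congr 1
  ext M
  simp only [Finset.mem_filter, Finset.mem_univ, true_and, mem_matchingsOn]
  constructor
  · rintro ⟨hM, hmax⟩
    have h1 := hmax M₀ hm₀
    rw [hcard M₀ hm₀, hcard M hM, hl₀] at h1
    exact ⟨hM, Finset.eq_univ_of_card _ (le_antisymm (Finset.card_le_univ _) h1),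
      Finset.subset_univ _⟩
  · rintro ⟨hM, hl, _⟩
    refine ⟨hM, fun M' hM' => ?_⟩
    rw [hcard M hM, hcard M' hM', hl]
    exact Finset.card_le_univ _

theorem nbhd_eq_colNbrs (G : Bigraph X Y E) (S : Finset X) :
    G.nbhd S = colNbrs G.mult Finset.univ S := by
  ext y
  simp only [nbhd, Finset.mem_filter, Finset.mem_univ, true_and, mem_colNbrs, mult_ne_zero]
  constructor
  · rintro ⟨e, he, hy⟩; exact ⟨_, he, e, rfl, hy⟩
  · rintro ⟨x, hx, e, rfl, hy⟩; exact ⟨e, hx, hy⟩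

theorem nbrsLeft_eq_colNbrs (G : Bigraph X Y E) (x : X) :
    G.nbrsLeft x = colNbrs G.mult Finset.univ {x} := by
  ext y
  simp [nbrsLeft, mem_colNbrs, mult_ne_zero]

theorem nbrsRight_eq_rowNbrs (G : Bigraph X Y E) (y : Y) :
    G.nbrsRight y = rowNbrs G.mult Finset.univ y := by
  ext x
  simp [nbrsRight, mem_rowNbrs, mult_ne_zero]

theorem total_mult (G : Bigraph X Y E) :
    total G.mult Finset.univ Finset.univ = Fintype.card E := by
  have h : ∀ x, ∑ y, G.mult x y = (Finset.univ.filter fun e => G.left e = x).card := by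
    intro x
    have := sum_edges_eq_sum_mult G x Finset.univ fun _ => 1
    simp only [mul_one, Finset.mem_univ, and_true] at this
    rw [Finset.card_eq_sum_ones, this]
  rw [total, Finset.sum_comm, Finset.sum_congr rfl fun x _ => h x,
    ← Finset.card_eq_sum_card_fiberwise (fun _ _ => Finset.mem_coe.2 (Finset.mem_univ _)),
    Finset.card_univ]

theorem isSurplusLeafless_mult {G : Bigraph X Y E} (h2 : 2 ≤ Fintype.card X)
    (hc : Fintype.card X ≤ Fintype.card Y) (hl : G.Leafless) (hs : G.XSurplus) :
    IsSurplusLeafless G.mult Finset.univ Finset.univ := by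
  refine ⟨h2, hc, fun S _ hne hSA => ?_, fun y _ => ?_⟩
  · rw [← nbhd_eq_colNbrs]
    exact hs S hne ((Finset.ssubset_iff_subset_ne).2 ⟨Finset.subset_univ _, hSA⟩)
  · rw [← nbrsRight_eq_rowNbrs]
    exact hl.2 y

theorem IsSurplusLeafless.leafless_of_mult {G : Bigraph X Y E}
    (h : IsSurplusLeafless G.mult Finset.univ Finset.univ) : G.Leafless := by
  refine ⟨fun x => ?_, fun y => ?_⟩
  · rw [nbrsLeft_eq_colNbrs]
    exact h.two_le_card_colNbrs (Finset.mem_univ x)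
  · rw [nbrsRight_eq_rowNbrs]
    exact h.leafless y (Finset.mem_univ y)

theorem IsSurplusLeafless.xSurplus_of_mult {G : Bigraph X Y E}
    (h : IsSurplusLeafless G.mult Finset.univ Finset.univ) : G.XSurplus := by
  intro S hne hS
  rw [nbhd_eq_colNbrs]
  exact h.surplus S (Finset.subset_univ _) hne hS.ne

theorem IsSurplusLeafless.Phi_eq {G : Bigraph X Y E}
    (h : IsSurplusLeafless G.mult Finset.univ Finset.univ) :
    G.Phi = matchCount G.mult Finset.univ Finset.univ :=
  Phi_eq_matchCount G (matchCount_pos_of_hall _ fun _ hS => h.hall hS)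

end Multiplicity

/-! ### The extremal graphs -/

section Extremal

theorem exists_mult_eq {n m N : ℕ} (w : Fin n → Fin m → ℕ)
    (h : total w Finset.univ Finset.univ = N) :
    ∃ G : Bigraph (Fin n) (Fin m) (Fin N), G.mult = w := by
  have hcard : Fintype.card (Σ c : Fin n × Fin m, Fin (w c.1 c.2)) = N := by
    rw [Fintype.card_sigma, ← h, total, Finset.sum_comm, Fintype.sum_prod_type]
    simp
  let φ := Fintype.equivFinOfCardEq hcard
  refine ⟨⟨fun e => (φ.symm e).1.1, fun e => (φ.symm e).1.2⟩, ?_⟩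
  funext x y
  rw [mult, ← Fintype.card_fin (w x y), ← Finset.card_univ]
  symm
  refine Finset.card_bij (fun i _ => φ ⟨(x, y), i⟩) (fun i _ => by simp) (fun i _ j _ hij => ?_)
    fun e he => ?_
  · simpa using hij
  · obtain ⟨⟨⟨x', y'⟩, i⟩, rfl⟩ := φ.surjective e
    simp only [Finset.mem_filter, Equiv.symm_apply_apply, Finset.mem_univ, true_and] at he
    obtain ⟨rfl, rfl⟩ := he
    exact ⟨i, Finset.mem_univ _, rfl⟩

theorem matchCount_map {X Y X' Y' : Type*} [DecidableEq X] [DecidableEq Y] [DecidableEq X']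
    [DecidableEq Y'] (w : X → Y → ℕ) (f : X' ↪ X) (g : Y' ↪ Y) (A : Finset X') (B : Finset Y') :
    matchCount w (A.map f) (B.map g) = matchCount (fun x y => w (f x) (g y)) A B := by
  induction A using Finset.induction_on generalizing B with
  | empty => simp [matchCount_empty]
  | insert a s ha ih =>
    rw [Finset.map_insert, matchCount_insert _ (by simpa using ha), matchCount_insert _ ha,
      Finset.sum_map]
    refine Finset.sum_congr rfl fun y _ => ?_
    rw [← Finset.map_erase, ih]

/-- The multiplicity matrix of an extremal graph with rows `0, …, m + 1`: a path
alternating between the rows and the columns `0, …, m`, whose end rows are both joined to all the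
further columns, with `b` additional copies of the first edge. -/
def extremalWeight (m b i j : ℕ) : ℕ :=
  if i = m + 1 then (if m ≤ j then 1 else 0)
  else if i = 0 then (if j = 0 then b + 1 else if m + 1 ≤ j then 1 else 0)
  else if j + 1 = i ∨ j = i then 1 else 0

variable {m b : ℕ}

/-- Without column `i` the path is forced from its end: row `i` takes column `i - 1`, and so on,
until row 0 chooses freely in `Z`. -/
theorem matchCount_extremal_short {i : ℕ} (hi : i ≤ m) {Z : Finset ℕ}
    (hZ : ∀ z ∈ Z, m + 1 ≤ z) :
    matchCount (extremalWeight m b) (Finset.range (i + 1)) (Finset.range i ∪ Z) = Z.card := by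
  induction i with
  | zero =>
    rw [matchCount_row _ (Finset.mem_range.2 Nat.zero_lt_one)]
    simp only [Finset.range_one, Finset.erase_singleton, matchCount_empty,
      Finset.range_zero, Finset.empty_union, mul_one]
    rw [Finset.card_eq_sum_ones]
    refine Finset.sum_congr rfl fun z hz => ?_
    have := hZ z hz
    unfold extremalWeight
    grind
  | succ i ih =>
    rw [Finset.range_add_one (n := i + 1), matchCount_insert _ Finset.notMem_range_self,
      Finset.sum_eq_single_of_mem i (by simp)]
    · have h1 : (Finset.range (i + 1) ∪ Z).erase i = Finset.range i ∪ Z := by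
        ext z
        simp only [Finset.mem_erase, Finset.mem_union, Finset.mem_range]
        constructor
        · rintro ⟨h1, h2 | h2⟩
          · left; omega
          · exact Or.inr h2
        · rintro (h2 | h2)
          · exact ⟨by omega, Or.inl (by omega)⟩
          · have := hZ z h2
            exact ⟨by omega, Or.inr h2⟩
      have h2 : extremalWeight m b (i + 1) i = 1 := by
        unfold extremalWeight; grind
      rw [h1, h2, ih (by omega), one_mul]
    · intro z hz hzi
      have h3 : z < i + 1 ∨ m + 1 ≤ z := by
        rcases Finset.mem_union.1 hz with h | h
        · exact Or.inl (Finset.mem_range.1 h)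
        · exact Or.inr (hZ z h)
      have h2 : extremalWeight m b (i + 1) z = 0 := by
        unfold extremalWeight; grind
      rw [h2, zero_mul]

/-- The last row takes its own column, leaving a shorter path of the same kind, or the previous
column, forcing all other rows but row 0. -/
theorem matchCount_extremal_long {i : ℕ} (hi : i ≤ m) {Z : Finset ℕ}
    (hZ : ∀ z ∈ Z, m + 1 ≤ z) :
    matchCount (extremalWeight m b) (Finset.range (i + 1)) (Finset.range (i + 1) ∪ Z) =
      b + 1 + Z.card + i * Z.card := by
  induction i with
  | zero =>
    rw [matchCount_row _ (Finset.mem_range.2 Nat.zero_lt_one)]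
    have h0 : 0 ∉ Z := fun h => by have := hZ 0 h; omega
    simp only [zero_add, Finset.range_one, Finset.erase_singleton, matchCount_empty, mul_one]
    rw [← Finset.insert_eq, Finset.sum_insert h0, Finset.card_eq_sum_ones]
    have h1 : ∑ z ∈ Z, extremalWeight m b 0 z = ∑ z ∈ Z, 1 := by
      refine Finset.sum_congr rfl fun z hz => ?_
      have := hZ z hz
      unfold extremalWeight
      grind
    rw [h1]
    simp [extremalWeight]
  | succ i ih =>
    have hne : i ≠ i + 1 := by omega
    have hsub : ({i, i + 1} : Finset ℕ) ⊆ Finset.range (i + 1 + 1) ∪ Z := by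
      intro z hz
      simp only [Finset.mem_insert, Finset.mem_singleton] at hz
      exact Finset.mem_union_left _ (Finset.mem_range.2 (by omega))
    have hw : ∀ z, z = i ∨ z = i + 1 → extremalWeight m b (i + 1) z = 1 := by
      intro z hz
      unfold extremalWeight; grind
    have h1 : (Finset.range (i + 1 + 1) ∪ Z).erase (i + 1) = Finset.range (i + 1) ∪ Z := by
      ext z
      simp only [Finset.mem_erase, Finset.mem_union, Finset.mem_range]
      constructor
      · rintro ⟨h1, h2 | h2⟩
        · left; omega
        · exact Or.inr h2
      · rintro (h2 | h2)
        · exact ⟨by omega, Or.inl (by omega)⟩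
        · have := hZ z h2
          exact ⟨by omega, Or.inr h2⟩
    have h2 : ((Finset.range (i + 1 + 1) ∪ Z).erase i).erase (i + 1) = Finset.range i ∪ Z := by
      rw [Finset.erase_right_comm, h1]
      ext z
      simp only [Finset.mem_erase, Finset.mem_union, Finset.mem_range]
      constructor
      · rintro ⟨h1, h2 | h2⟩
        · left; omega
        · exact Or.inr h2
      · rintro (h2 | h2)
        · exact ⟨by omega, Or.inl (by omega)⟩
        · have := hZ z h2
          exact ⟨by omega, Or.inr h2⟩
    have h3 : matchCount (extremalWeight m b) (Finset.range (i + 1))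
        ((Finset.range (i + 1 + 1) ∪ Z).erase i) = Z.card := by
      rw [← matchCount_erase_of_col_zero (y := i + 1), h2,
        matchCount_extremal_short (by omega) hZ]
      intro x hx
      have := Finset.mem_range.1 hx
      unfold extremalWeight; grind
    rw [matchCount_row _ (Finset.self_mem_range_succ (i + 1)), ← Finset.sum_subset hsub,
      Finset.sum_pair hne]
    · have h4 : (Finset.range (i + 1 + 1)).erase (i + 1) = Finset.range (i + 1) := by
        rw [Finset.range_add_one (n := i + 1), Finset.erase_insert Finset.notMem_range_self]
      rw [hw i (Or.inl rfl), hw (i + 1) (Or.inr rfl), h4, h1, h3, ih (by omega)]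
      ring
    · intro z _ hz
      simp only [Finset.mem_insert, Finset.mem_singleton, not_or] at hz
      have h5 : extremalWeight m b (i + 1) z = 0 := by
        unfold extremalWeight; grind
      rw [h5, zero_mul]

theorem matchCount_extremal (m b t : ℕ) :
    matchCount (extremalWeight m b) (Finset.range (m + 2)) (Finset.range (m + 2 + t)) =
      ((m + 1) * t + 2 + b) * (t + 1) := by
  set Z := Finset.Ico (m + 1) (m + 2 + t) with hZdef
  have hZ : ∀ z ∈ Z, m + 1 ≤ z := fun z hz => (Finset.mem_Ico.1 hz).1
  have hZc : Z.card = t + 1 := by rw [hZdef, Nat.card_Ico]; omega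
  have hmZ : m ∉ Z := fun h => by have := hZ m h; omega
  have hB : Finset.range (m + 2 + t) = Finset.range (m + 1) ∪ Z := by
    ext z
    simp only [hZdef, Finset.mem_union, Finset.mem_range, Finset.mem_Ico]
    omega
  have hsub : insert m Z ⊆ Finset.range (m + 1) ∪ Z := by
    intro z hz
    rcases Finset.mem_insert.1 hz with rfl | h
    · simp
    · exact Finset.mem_union_right _ h
  have hw : ∀ z, m ≤ z → extremalWeight m b (m + 1) z = 1 := by
    intro z hz; simp [extremalWeight, hz]
  have h1 : (Finset.range (m + 1) ∪ Z).erase m = Finset.range m ∪ Z := by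
    ext z
    simp only [Finset.mem_erase, Finset.mem_union, Finset.mem_range]
    constructor
    · rintro ⟨h1, h2 | h2⟩
      · left; omega
      · exact Or.inr h2
    · rintro (h2 | h2)
      · exact ⟨by omega, Or.inl (by omega)⟩
      · have := hZ z h2
        exact ⟨by omega, Or.inr h2⟩
  have h2 : ∀ z ∈ Z, (Finset.range (m + 1) ∪ Z).erase z = Finset.range (m + 1) ∪ Z.erase z := by
    intro z hz
    have hz' := hZ z hz
    rw [Finset.erase_union_distrib, Finset.erase_eq_of_notMem (s := Finset.range (m + 1))]
    simp only [Finset.mem_range]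
    omega
  rw [hB, Finset.range_add_one (n := m + 1), matchCount_insert _ Finset.notMem_range_self,
    ← Finset.sum_subset hsub, Finset.sum_insert hmZ, hw m le_rfl, h1,
    matchCount_extremal_short le_rfl hZ, hZc, one_mul]
  · have h3 : ∀ z ∈ Z, extremalWeight m b (m + 1) z *
        matchCount (extremalWeight m b) (Finset.range (m + 1))
          ((Finset.range (m + 1) ∪ Z).erase z) = b + 1 + t + m * t := by
      intro z hz
      have hc := Finset.card_erase_add_one hz
      rw [hw z (by have := hZ z hz; omega), h2 z hz, one_mul,
        matchCount_extremal_long le_rfl fun x hx => hZ x (Finset.mem_of_mem_erase hx),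
        (by omega : (Z.erase z).card = t)]
    rw [Finset.sum_congr rfl h3, Finset.sum_const, hZc, smul_eq_mul]
    ring
  · intro z hz hz'
    simp only [Finset.mem_insert, not_or] at hz'
    have hz2 : z < m + 1 := by
      rcases Finset.mem_union.1 hz with h | h
      · exact Finset.mem_range.1 h
      · exact absurd h hz'.2
    have h5 : extremalWeight m b (m + 1) z = 0 := by
      unfold extremalWeight; grind
    rw [h5, zero_mul]

theorem matchCount_extremal_fin (m b t : ℕ) :
    matchCount (fun (x : Fin (m + 2)) (y : Fin (m + 2 + t)) => extremalWeight m b x y)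
      Finset.univ Finset.univ = ((m + 1) * t + 2 + b) * (t + 1) := by
  rw [← matchCount_extremal, ← Nat.Iio_eq_range, ← Nat.Iio_eq_range, ← Fin.map_valEmbedding_univ,
    ← Fin.map_valEmbedding_univ, matchCount_map]
  rfl

theorem exists_extremal_rows (m b j : ℕ) : ∃ i₁ i₂, i₁ < i₂ ∧ i₂ < m + 2 ∧
    extremalWeight m b i₁ j = (if j = 0 then b + 1 else 1) ∧ extremalWeight m b i₂ j = 1 ∧
    ∀ i < m + 2, i ≠ i₁ → i ≠ i₂ → extremalWeight m b i j = 0 := by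
  by_cases hj : j ≤ m
  · refine ⟨j, j + 1, by omega, by omega, ?_, ?_, fun i hi h1 h2 => ?_⟩ <;>
      unfold extremalWeight <;> grind
  · refine ⟨0, m + 1, by omega, by omega, ?_, ?_, fun i hi h1 h2 => ?_⟩ <;>
      unfold extremalWeight <;> grind

theorem total_extremal (m b t : ℕ) :
    total (fun (x : Fin (m + 2)) (y : Fin (m + 2 + t)) => extremalWeight m b x y)
      Finset.univ Finset.univ = 2 * (m + 2 + t) + b := by
  have h : ∀ y : Fin (m + 2 + t), ∑ x : Fin (m + 2), extremalWeight m b x y =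
      2 + if (y : ℕ) = 0 then b else 0 := by
    intro y
    obtain ⟨i₁, i₂, h1, h2, h3, h4, h5⟩ := exists_extremal_rows m b y
    rw [Finset.sum_eq_add (⟨i₁, by omega⟩ : Fin (m + 2)) ⟨i₂, h2⟩
      (fun he => by rw [Fin.mk.injEq] at he; omega)
      (fun i _ hi => h5 i i.2 (fun he => hi.1 (Fin.ext he)) (fun he => hi.2 (Fin.ext he)))
      (fun h => absurd (Finset.mem_univ _) h) (fun h => absurd (Finset.mem_univ _) h)]
    simp only [h3, h4]
    split_ifs <;> omega
  have hb : ∑ y : Fin (m + 2 + t), (if (y : ℕ) = 0 then b else 0) = b := by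
    rw [Finset.sum_eq_single_of_mem (⟨0, by omega⟩ : Fin (m + 2 + t)) (Finset.mem_univ _)]
    · exact if_pos rfl
    · exact fun y _ hy => if_neg fun he => hy (Fin.ext he)
  rw [total, Finset.sum_congr rfl fun y _ => h y, Finset.sum_add_distrib, hb]
  simp [mul_comm]

theorem isSurplusLeafless_extremal (m b t : ℕ) :
    IsSurplusLeafless (fun (x : Fin (m + 2)) (y : Fin (m + 2 + t)) => extremalWeight m b x y)
      Finset.univ Finset.univ := by
  refine ⟨by simp, by simp, fun S _ hne hSA => ?_, fun y _ => ?_⟩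
  -- Row i meets columns i and i - 1, indices read cyclically among the first m + 2. So `S` sees its
  -- own indices, and one more, since only the full set is closed under cyclic predecessors.
  · have hext : ∃ i : Fin (m + 2), i ∉ S ∧ ∃ x ∈ S, extremalWeight m b x i ≠ 0 := by
      by_contra hno
      push Not at hno
      have hpred : ∀ i : Fin (m + 2), ∀ x ∈ S, extremalWeight m b x i ≠ 0 → i ∈ S := by
        intro i x hx hw
        by_contra hi
        exact hw (hno i hi x hx)
      have hdown : ∀ d i : ℕ, ∀ hi : i + d < m + 2, (⟨i + d, hi⟩ : Fin (m + 2)) ∈ S →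
          (⟨i, by omega⟩ : Fin (m + 2)) ∈ S := by
        intro d
        induction d with
        | zero => intro i hi h; exact h
        | succ d ih =>
          intro i hi h
          refine ih i (by omega) (hpred _ _ h ?_)
          change extremalWeight m b (i + (d + 1)) (i + d) ≠ 0
          unfold extremalWeight; grind
      obtain ⟨x, hx⟩ := hne
      have h0 : (⟨0, by omega⟩ : Fin (m + 2)) ∈ S :=
        hdown x 0 (by have := x.2; omega) (by simpa using hx)
      have hlast : (⟨m + 1, by omega⟩ : Fin (m + 2)) ∈ S := by
        refine hpred _ _ h0 ?_
        change extremalWeight m b 0 (m + 1) ≠ 0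
        unfold extremalWeight; grind
      refine hSA (Finset.eq_univ_of_forall fun z => ?_)
      have hz := z.2
      refine hdown (m + 1 - z) z (by omega) ?_
      have : (⟨z + (m + 1 - z), by omega⟩ : Fin (m + 2)) = ⟨m + 1, by omega⟩ :=
        Fin.ext (by simp only; omega)
      rw [this]
      exact hlast
    obtain ⟨i, hi, x, hx, hw⟩ := hext
    have hle : m + 2 ≤ m + 2 + t := by omega
    have hsub : (insert i S).map (Fin.castLEEmb hle) ⊆
        colNbrs (fun (x : Fin (m + 2)) (y : Fin (m + 2 + t)) => extremalWeight m b x y)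
          Finset.univ S := by
      intro y hy
      obtain ⟨z, hz, rfl⟩ := Finset.mem_map.1 hy
      refine mem_colNbrs.2 ⟨Finset.mem_univ _, ?_⟩
      rcases Finset.mem_insert.1 hz with rfl | hz
      · exact ⟨x, hx, hw⟩
      · refine ⟨z, hz, ?_⟩
        have := z.2
        change extremalWeight m b z z ≠ 0
        unfold extremalWeight
        grind
    have h1 := Finset.card_le_card hsub
    rw [Finset.card_map, Finset.card_insert_of_notMem hi] at h1
    exact h1
  · obtain ⟨i₁, i₂, h1, h2, h3, h4, _⟩ := exists_extremal_rows m b y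
    refine Finset.one_lt_card.2 ⟨⟨i₁, by omega⟩, mem_rowNbrs.2 ⟨Finset.mem_univ _, ?_⟩, ⟨i₂, h2⟩,
      mem_rowNbrs.2 ⟨Finset.mem_univ _, ?_⟩, fun he => ?_⟩
    · simp only [h3]; split_ifs <;> omega
    · simp only [h4]; omega
    · rw [Fin.mk.injEq] at he; omega

end Extremal

end Bigraph

theorem theorem1p5 :
    (∀ (X Y E : Type*) [Fintype X] [Fintype Y] [Fintype E] (G : Bigraph X Y E) (n t b : ℤ),
      n = Fintype.card X → t = (Fintype.card Y : ℤ) - Fintype.card X →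
      b = (Fintype.card E : ℤ) - 2 * Fintype.card Y →
      2 ≤ n → 0 ≤ t → G.Leafless → G.XSurplus →
      ((n - 1) * t + 2 + b) * (t + 1) ≤ (G.Phi : ℤ)) ∧
    (∀ n t b : ℕ, 2 ≤ n →
      ∃ G : Bigraph (Fin n) (Fin (n + t)) (Fin (2 * (n + t) + b)),
        G.Leafless ∧ G.XSurplus ∧
        (G.Phi : ℤ) = (((n : ℤ) - 1) * t + 2 + b) * (t + 1)) := by
  constructor
  · intro X Y E _ _ _ G n t b hn ht hb hn2 ht0 hl hs
    classical
    have h := Bigraph.isSurplusLeafless_mult (G := G) (by omega) (by omega) hl hs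
    have htot := Bigraph.total_mult G
    have hge := h.two_mul_card_le_total
    rw [htot, Finset.card_univ] at hge
    obtain ⟨m, hm⟩ : ∃ m, Fintype.card X = m + 2 := ⟨Fintype.card X - 2, by omega⟩
    obtain ⟨t', ht'⟩ : ∃ t', Fintype.card Y = m + 2 + t' :=
      ⟨Fintype.card Y - (m + 2), by omega⟩
    obtain ⟨b', hb'⟩ : ∃ b', Fintype.card E = 2 * (m + 2 + t') + b' :=
      ⟨Fintype.card E - 2 * (m + 2 + t'), by omega⟩
    have hmain := h.boundHolds m t' b' (by rw [Finset.card_univ, hm])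
      (by rw [Finset.card_univ, ht']) (by rw [htot, hb'])
    rw [h.Phi_eq]
    have e1 : n - 1 = (m : ℤ) + 1 := by omega
    have e2 : t = t' := by omega
    have e3 : b = b' := by omega
    rw [e1, e2, e3]
    exact_mod_cast hmain
  · intro n t b hn
    obtain ⟨m, rfl⟩ : ∃ m, n = m + 2 := ⟨n - 2, by omega⟩
    obtain ⟨G, hG⟩ := Bigraph.exists_mult_eq _ (Bigraph.total_extremal m b t)
    have h := Bigraph.isSurplusLeafless_extremal m b t
    rw [← hG] at h
    refine ⟨G, h.leafless_of_mult, h.xSurplus_of_mult, ?_⟩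
    rw [h.Phi_eq, hG, Bigraph.matchCount_extremal_fin]
    push_cast
    ring
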